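/- **Theorem 5.** Let $n_1,n_2,n_3\in\mathbb N$, let $I_1,I_2,I_3$ be the three successive blocks of indices of sizes $n_1,n_2,n_3$ in $\{1,\dots,n\}$, $n=n_1+n_2+n_3$, let $a_\mu\in(0,1)$ for $1\le\mu\le n$, $\vec a_j=(a_\mu)_{\mu\in I_j}$ (a column), and let $\Theta=(\vartheta_{ij})$ be a real non-singular $3\times3$ correlation matrix. Put $\vartheta_j=\vartheta_{ik}$ for $\{i,j,k\}=\{1,2,3\}$, and let $$R_\Theta=D+(\vartheta_{ij}\,\vec a_i\vec a_j')_{i,j=1,2,3},\qquad D=\mathrm{Diag}(1-a_1^2,\dots,1-a_n^2).$$ *Notation.* $g_\alpha$ denotes the standard gamma density $x^{\alpha-1}e^{-x}/\Gamma(\alpha)$, $x>0$, $G_\alpha$ its cdf, $G_\alpha(x;y)=e^{-y}\sum_{m\ge0}G_{\alpha+m}(x)\,y^m/m!$ the non-central gamma cdf, $L_k^{(\alpha-1)}$ the generalized Laguerre polynomials, $(\alpha)_k=\alpha(\alpha+1)\cdots(\alpha+k-1)$, and for $k\in\mathbb N_0$, $\vec x_j=(x_\mu)_{\mu\in I_j}$,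 $$c_{j,k}(\vec x_j;\alpha,\vec a_j)=\binom{\alpha+k-1}{k}^{-1}\int_0^\infty\Big(\prod_{\mu\in I_j}G_\alpha\big((1-a_\mu^2)^{-1}x_\mu;(1-a_\mu^2)^{-1}a_\mu^2y\big)\Big)L_k^{(\alpha-1)}(y)\,g_\alpha(y)\,dy .$$ With $p_j=\sum_{\mu\in I_j}a_\mu^2/(1-a_\mu^2)$ and $d_j=p_j/(1+p_j)$ let $\zeta_j=d_j\cos(\gamma_j)e^{i\gamma_j}$ and $$\rho^2(\gamma_1,\gamma_2,\gamma_3)=\big|\vartheta_1^2\zeta_2\zeta_3+\vartheta_2^2\zeta_1\zeta_3+\vartheta_3^2\zeta_1\zeta_2-2\vartheta_1\vartheta_2\vartheta_3\zeta_1\zeta_2\zeta_3\big|^2,\qquad |\gamma_j|\le\tfrac{\pi}{2}.$$ (a) Suppose that $\max\rho^2<1$, the maximum being taken over all $|\gamma_1|,|\gamma_2|,|\gamma_3|\le\pi/2$. Let $\alpha>0$ be such that the $\Gamma_n(\alpha,R_\Theta)$-distribution exists, i.e. the probability distribution on $[0,\infty)^n$ with the Laplace transform $|I_n+R_\Theta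 T|^{-\alpha}$, $T=\mathrm{Diag}(t_1,\dots,t_n)$, $t_\mu\ge0$. Then for all real $x_1,\dots,x_n$ its cdf is $$F(x_1,\dots,x_n;\alpha,R_\Theta)=\sum_{k=0}^\infty\ \sum_{k_1+k_2+k_3+k_4=k}(\alpha)_k\frac{(-2)^{k_4}}{k_4!}\prod_{j=1}^3\frac{\vartheta_j^{2k_j+k_4}}{k_j!}\,c_{j,k-k_j}(\vec x_j;\alpha,\vec a_j),$$ where the inner finite sum runs over $k_1,\dots,k_4\in\mathbb N_0$ and the outer series over $k$ converges absolutely. (b) With $\tilde\vartheta_{jk}=\vartheta_{jk}\sqrt{d_jd_k}$, the condition $\sum_{1\le j<k\le3}\tilde\vartheta_{jk}^4\le1$ implies $\max\rho^2<1$. -/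

import Mathlib

open MeasureTheory ProbabilityTheory
open scoped Nat

/-- A non-singular correlation matrix: real symmetric positive definite with unit diagonal. -/
def IsNonsingularCorrelation {ι : Type*} [Fintype ι] [DecidableEq ι]
    (R : Matrix ι ι ℝ) : Prop :=
  R.PosDef ∧ ∀ i, R i i = 1

/-- `μ` is the multivariate gamma distribution `Γ_n(α, R)` (in the sense of Krishnamoorthy and
Parthasarathy): the probability distribution on the non-negative orthant with Laplace transform
`|I + R T|^{-α}`, `T = Diag(t₁, …, tₙ)`, `tᵢ ≥ 0`. -/
structure IsMultivariateGamma {ι : Type*} [Fintype ι] [DecidableEq ι]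
    (α : ℝ) (R : Matrix ι ι ℝ) (μ : Measure (ι → ℝ)) : Prop where
  isProbabilityMeasure : IsProbabilityMeasure μ
  nonneg : ∀ᵐ x ∂μ, ∀ i, 0 ≤ x i
  laplace : ∀ t : ι → ℝ, (∀ i, 0 ≤ t i) →
    ∫ x, Real.exp (-∑ i, t i * x i) ∂μ = (1 + R * Matrix.diagonal t).det ^ (-α)

/-- The matrix `R_Θ = D + (ϑ_ij a_i a_j')` with successive one-factor blocks of sizes `n j` and
`D = Diag(…, 1 - a_μ², …)`. -/
def blockCorrelation {p : ℕ} {n : Fin p → ℕ} (Θ : Matrix (Fin p) (Fin p) ℝ)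
    (a : (j : Fin p) → Fin (n j) → ℝ) :
    Matrix ((j : Fin p) × Fin (n j)) ((j : Fin p) × Fin (n j)) ℝ :=
  Matrix.diagonal (fun u => 1 - a u.1 u.2 ^ 2) +
    Matrix.of fun u v => Θ u.1 v.1 * a u.1 u.2 * a v.1 v.2

/-- The non-central gamma cdf `G_α(x; y) = e^{-y} ∑ₙ G_{α+n}(x) yⁿ / n!`, where `G_β` is the cdf of
the standard gamma distribution with shape parameter `β`. -/
noncomputable def noncentralGammaCDF (α x y : ℝ) : ℝ :=
  Real.exp (-y) * ∑' m : ℕ, cdf (gammaMeasure (α + m) 1) x * (y ^ m / (m ! : ℝ))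

/-- The generalized Laguerre polynomial `L_k^{(β)}` evaluated at `y`. -/
noncomputable def laguerreL (k : ℕ) (β y : ℝ) : ℝ :=
  ∑ m ∈ Finset.range (k + 1),
    (-1 : ℝ) ^ m * Ring.choose ((k : ℝ) + β) (k - m) * (y ^ m / (m ! : ℝ))

/-- The Laguerre coefficient `c_k(x; α, a)` of a product of non-central gamma cdfs, for one block
with factor `a` and arguments `x`. -/
noncomputable def laguerreCoeff {m : ℕ} (k : ℕ) (x : Fin m → ℝ) (α : ℝ) (a : Fin m → ℝ) : ℝ :=
  (Ring.choose (α + (k : ℝ) - 1) k)⁻¹ *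
    ∫ y in Set.Ioi (0 : ℝ),
      (∏ i, noncentralGammaCDF α ((1 - a i ^ 2)⁻¹ * x i) ((1 - a i ^ 2)⁻¹ * a i ^ 2 * y)) *
        laguerreL k (α - 1) y * gammaPDFReal α 1 y

/-- `ϑ_j = ϑ_{ik}` with `{i, j, k}` the set of the three block indices (addition in `Fin 3` is
modulo 3). -/
def oppositeCorr (Θ : Matrix (Fin 3) (Fin 3) ℝ) (j : Fin 3) : ℝ :=
  Θ (j + 1) (j + 2)

/-- `d = p / (1 + p)` with `p = ∑ a_μ² / (1 - a_μ²)`, for one block with factor `a`. -/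
noncomputable def blockRadius {m : ℕ} (a : Fin m → ℝ) : ℝ :=
  (∑ i, a i ^ 2 / (1 - a i ^ 2)) / (1 + ∑ i, a i ^ 2 / (1 - a i ^ 2))

/-- `ϑ̃_j = ϑ_{ik} (d_i d_k)^{1/2}`. -/
noncomputable def scaledCorr {n : Fin 3 → ℕ} (Θ : Matrix (Fin 3) (Fin 3) ℝ)
    (a : (j : Fin 3) → Fin (n j) → ℝ) (j : Fin 3) : ℝ :=
  oppositeCorr Θ j * Real.sqrt (blockRadius (a (j + 1)) * blockRadius (a (j + 2)))

/-- The point `ζ_j = d_j cos(γ) e^{iγ}` of the circle belonging to one block with factor `a`. -/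
noncomputable def circlePoint {m : ℕ} (a : Fin m → ℝ) (γ : ℝ) : ℂ :=
  (blockRadius a : ℂ) * (Real.cos γ : ℂ) * Complex.exp (Complex.I * (γ : ℂ))

/-- The function `ρ²(γ₁, γ₂, γ₃) =
|ϑ₁² ζ₂ ζ₃ + ϑ₂² ζ₁ ζ₃ + ϑ₃² ζ₁ ζ₂ - 2 ϑ₁ ϑ₂ ϑ₃ ζ₁ ζ₂ ζ₃|²`. -/
noncomputable def rhoSq {n : Fin 3 → ℕ} (Θ : Matrix (Fin 3) (Fin 3) ℝ)
    (a : (j : Fin 3) → Fin (n j) → ℝ) (γ : Fin 3 → ℝ) : ℝ :=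
  ‖(∑ j : Fin 3, (oppositeCorr Θ j : ℂ) ^ 2 *
        circlePoint (a (j + 1)) (γ (j + 1)) * circlePoint (a (j + 2)) (γ (j + 2)))
      - 2 * ∏ j : Fin 3, ((oppositeCorr Θ j : ℂ) * circlePoint (a j) (γ j))‖ ^ 2

/-- The convergence condition `max ρ² < 1`, the maximum being taken over all angles
`|γ_j| ≤ π / 2`. -/
def MaxRhoSqLtOne {n : Fin 3 → ℕ} (Θ : Matrix (Fin 3) (Fin 3) ℝ)
    (a : (j : Fin 3) → Fin (n j) → ℝ) : Prop :=
  ∃ M : ℝ, IsGreatest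
    (rhoSq Θ a '' {γ : Fin 3 → ℝ | ∀ j, γ j ∈ Set.Icc (-(Real.pi / 2)) (Real.pi / 2)}) M ∧ M < 1

/-- The `k`-th term of the series, the finite sum over all decompositions
`k = k₁ + k₂ + k₃ + k₄` with `k_j ∈ ℕ₀` (in Lean: `κ 0, κ 1, κ 2, κ 3`). -/
noncomputable def gammaSeriesTerm {n : Fin 3 → ℕ} (α : ℝ) (Θ : Matrix (Fin 3) (Fin 3) ℝ)
    (a : (j : Fin 3) → Fin (n j) → ℝ) (x : ((j : Fin 3) × Fin (n j)) → ℝ) (k : ℕ) : ℝ :=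
  ∑ κ ∈ Finset.Nat.antidiagonalTuple 4 k,
    (ascPochhammer ℝ k).eval α * ((-2 : ℝ) ^ κ 3 / ((κ 3)! : ℝ)) *
      ∏ j : Fin 3, (oppositeCorr Θ j ^ (2 * κ j.castSucc + κ 3) / ((κ j.castSucc)! : ℝ) *
        laguerreCoeff (k - κ j.castSucc) (fun i => x ⟨j, i⟩) α (a j))

/-!
Both sides of (a) vanish unless `x ≥ 0` and are bounded by a multiple of `exp (∑ x_μ)`, so it
suffices to compare their multivariate Laplace transforms at `s_μ > 1`. The transform of a block
coefficient `c_{j,k}` is a constant times `u_j ^ k`, where `u_j = z_j / (1 + z_j)` and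
`z_j = ∑ a_μ² s_μ / (1 + (1 - a_μ²) s_μ)`. Summing over `k₁ + k₂ + k₃ + k₄ = k` by the multinomial
theorem turns the `k`-th term into `(α)_k / k! * Q(u) ^ k`, up to a common factor, and the binomial
series gives `(1 - Q(u)) ^ (-α)`, which is the transform of the distribution function up to the
same factor since `det (1 + Θ diag z) = ∏ (1 + z_j) * (1 - Q(u))`.

Each `u_j` lies in the disc with diameter `[0, d_j]`, whose boundary is traced by `ζ_j`. The maximum
principle in each variable therefore gives `|Q(u)| ≤ max ρ < 1`, and inverting the transform on a
vertical line bounds the `k`-th term by `(α)_k / k! * q ^ k` times an exponential, so that the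
series converges and may be transformed term by term.

For (b), after dividing by `∏ e^{iγ_j}` the real and imaginary parts of `Q(ζ)` are
`Q(d) ∏ cos γ_j` and `-∑ ϑ̃_j² sin γ_j cos γ_{j+1} cos γ_{j+2}`, and the Cauchy-Schwarz inequality
applies because the squares of these trigonometric products sum to at most `1`.
-/

open Set Filter
open scoped Topology

/-! ### Gamma densities and Laguerre polynomials -/

lemma one_add_ne_zero_of_re_nonneg {z : ℂ} (hz : 0 ≤ z.re) : 1 + z ≠ 0 := fun h => by
  have := congrArg Complex.re h
  simp only [Complex.add_re, Complex.one_re, Complex.zero_re] at this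
  linarith

lemma norm_exp_neg_mul_ofReal (s : ℂ) (x : ℝ) :
    ‖Complex.exp (-(s * x))‖ = Real.exp (-(s.re * x)) := by
  simp [Complex.norm_exp]

lemma eqOn_of_eventually_eq_ofReal {f g : ℂ → ℂ} {U : Set ℂ} (hf : AnalyticOnNhd ℂ f U)
    (hg : AnalyticOnNhd ℂ g U) (hU : IsPreconnected U) {x : ℝ} (hx : (x : ℂ) ∈ U)
    (h : ∀ᶠ t : ℝ in 𝓝 x, f t = g t) : EqOn f g U := by
  have htendsto : Tendsto ((↑) : ℝ → ℂ) (𝓝[≠] x) (𝓝[≠] (x : ℂ)) :=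
    Complex.continuous_ofReal.continuousWithinAt.tendsto_nhdsWithin fun t ht => by simpa using ht
  exact hf.eqOn_of_preconnected_of_frequently_eq hg hU hx
    (htendsto.frequently (h.filter_mono nhdsWithin_le_nhds).frequently)

lemma gammaPDFReal_one_of_pos {β y : ℝ} (hy : 0 < y) :
    gammaPDFReal β 1 y = (Real.Gamma β)⁻¹ * (y ^ (β - 1) * Real.exp (-y)) := by
  simp [gammaPDFReal, hy.le, mul_assoc]

lemma integrable_gammaPDFReal {β r : ℝ} (hβ : 0 < β) (hr : 0 < r) :
    Integrable (gammaPDFReal β r) := by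
  refine ⟨by fun_prop, ?_⟩
  rw [hasFiniteIntegral_iff_ofReal (ae_of_all _ (gammaPDFReal_nonneg hβ hr))]
  exact (lintegral_gammaPDF_eq_one hβ hr).trans_lt ENNReal.one_lt_top

lemma integral_gammaMeasure {E : Type*} [NormedAddCommGroup E] [NormedSpace ℝ E] {β r : ℝ}
    (hβ : 0 < β) (hr : 0 < r) (f : ℝ → E) :
    ∫ y, f y ∂(gammaMeasure β r) = ∫ y in Ioi 0, gammaPDFReal β r y • f y := by
  rw [gammaMeasure, integral_withDensity_eq_integral_toReal_smul
    (by unfold gammaPDF; fun_prop) (ae_of_all _ fun x => by simp [gammaPDF]),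
    ← integral_Ici_eq_integral_Ioi, ← integral_indicator measurableSet_Ici]
  congr 1 with y
  by_cases hy : 0 ≤ y
  · simp [hy, gammaPDF, gammaPDFReal_nonneg hβ hr]
  · simp [hy, gammaPDF_of_neg (not_le.1 hy)]

lemma mgf_id_gammaMeasure {β r t : ℝ} (hβ : 0 < β) (hr : 0 < r) (ht : t < r) :
    mgf id (gammaMeasure β r) t = (1 - t / r) ^ (-β) := by
  have hrt : 0 < r - t := sub_pos.2 ht
  have hdensity : ∀ y ∈ Ioi (0 : ℝ), gammaPDFReal β r y • Real.exp (t * y) =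
      r ^ β / Real.Gamma β * (y ^ (β - 1) * Real.exp (-((r - t) * y))) := fun y hy => by
    rw [gammaPDFReal, if_pos (mem_Ioi.1 hy).le,
      show -((r - t) * y) = -(r * y) + t * y by ring, Real.exp_add, smul_eq_mul]
    ring
  calc mgf id (gammaMeasure β r) t
      = r ^ β / Real.Gamma β * ((1 / (r - t)) ^ β * Real.Gamma β) := by
        simp only [mgf, id]
        rw [integral_gammaMeasure hβ hr, setIntegral_congr_fun measurableSet_Ioi hdensity,
          integral_const_mul, Real.integral_rpow_mul_exp_neg_mul_Ioi hβ hrt]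
    _ = (r * (1 / (r - t))) ^ β := by
        rw [Real.mul_rpow hr.le (by positivity)]
        field_simp [(Real.Gamma_pos_of_pos hβ).ne']
    _ = (1 - t / r) ^ (-β) := by
        rw [Real.rpow_neg_eq_inv_rpow]
        congr 1
        field_simp

lemma integrable_exp_mul_gammaMeasure {β r t : ℝ} (hβ : 0 < β) (hr : 0 < r) (ht : t < r) :
    Integrable (fun y => Real.exp (t * y)) (gammaMeasure β r) := by
  by_contra h
  have hmgf := mgf_id_gammaMeasure hβ hr ht
  rw [mgf, show ∫ y, Real.exp (t * id y) ∂gammaMeasure β r = 0 from integral_undef h] at hmgf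
  have : 0 < 1 - t / r := sub_pos.2 ((div_lt_one hr).2 ht)
  exact (Real.rpow_pos_of_pos this _).ne hmgf

lemma complexMGF_id_gammaMeasure {β r : ℝ} (hβ : 0 < β) (hr : 0 < r) {w : ℂ} (hw : w.re < r) :
    complexMGF id (gammaMeasure β r) w = (1 - w / r) ^ (-(β : ℂ)) := by
  have hset : Iio r ⊆ interior (integrableExpSet id (gammaMeasure β r)) :=
    interior_maximal (fun t ht => integrable_exp_mul_gammaMeasure hβ hr ht) isOpen_Iio
  refine eqOn_of_eventually_eq_ofReal (U := {w : ℂ | w.re < r}) (x := 0)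
    (f := complexMGF id (gammaMeasure β r)) (g := fun w => (1 - w / r) ^ (-(β : ℂ)))
    (fun w hw => analyticOnNhd_complexMGF w (hset hw)) ?_ (convex_halfSpace_re_lt r).isPreconnected
    (by simpa using hr) ?_ hw
  · refine DifferentiableOn.analyticOnNhd (fun w hw => ?_)
      (isOpen_lt Complex.continuous_re continuous_const)
    refine DifferentiableAt.differentiableWithinAt (.cpow (by fun_prop) (by fun_prop) (.inl ?_))
    rw [Complex.sub_re, Complex.one_re, Complex.div_ofReal_re, sub_pos]
    exact (div_lt_one hr).2 hw
  · filter_upwards [Iio_mem_nhds hr] with t ht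
    rw [complexMGF_ofReal, mgf_id_gammaMeasure hβ hr ht,
      Complex.ofReal_cpow (sub_nonneg.2 ((div_lt_one hr).2 ht).le)]
    push_cast
    rfl

lemma integral_exp_neg_mul_gammaPDFReal {β r : ℝ} (hβ : 0 < β) (hr : 0 < r) {z : ℂ}
    (hz : -r < z.re) :
    ∫ y in Ioi (0 : ℝ), Complex.exp (-(z * y)) * (gammaPDFReal β r y : ℂ) =
      (1 + z / r) ^ (-(β : ℂ)) := by
  have h := complexMGF_id_gammaMeasure hβ hr (w := -z) (by simpa using neg_lt.1 hz)
  rw [complexMGF, integral_gammaMeasure hβ hr, neg_div, sub_neg_eq_add] at h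
  rw [← h]
  simp [mul_comm]

lemma pow_mul_gammaPDFReal {β y : ℝ} (hβ : 0 < β) (hy : 0 < y) (m : ℕ) :
    y ^ m * gammaPDFReal β 1 y = (ascPochhammer ℝ m).eval β * gammaPDFReal (β + m) 1 y := by
  induction m with
  | zero => simp
  | succ m ih =>
    have hm : 0 < β + m := by positivity
    rw [pow_succ', mul_assoc, ih, ascPochhammer_succ_eval, mul_left_comm, mul_assoc,
      gammaPDFReal_one_of_pos hy, gammaPDFReal_one_of_pos hy]
    push_cast
    rw [← add_assoc, Real.Gamma_add_one hm.ne', add_sub_cancel_right, mul_inv,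
      Real.rpow_sub_one hy.ne']
    field_simp

lemma ring_choose_add_eq_ascPochhammer (r : ℝ) (n : ℕ) :
    Ring.choose (r + n - 1) n = (ascPochhammer ℝ n).eval r / n ! := by
  rw [← Ring.multichoose_eq, eq_div_iff (by positivity), mul_comm, ← nsmul_eq_mul,
    Ring.factorial_nsmul_multichoose_eq_ascPochhammer, Polynomial.ascPochhammer_smeval_eq_eval]

lemma ascPochhammer_eval_mul_eval_add (x : ℝ) (m n : ℕ) :
    (ascPochhammer ℝ m).eval x * (ascPochhammer ℝ n).eval (x + m) =
      (ascPochhammer ℝ (m + n)).eval x := by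
  simp [← ascPochhammer_mul]

lemma laguerreL_mul_gammaPDFReal {α y : ℝ} (hα : 0 < α) (hy : 0 < y) (k : ℕ) :
    laguerreL k (α - 1) y * gammaPDFReal α 1 y = (ascPochhammer ℝ k).eval α / k ! *
      ∑ m ∈ Finset.range (k + 1), (-1 : ℝ) ^ m * k.choose m * gammaPDFReal (α + m) 1 y := by
  rw [laguerreL, Finset.sum_mul, Finset.mul_sum]
  refine Finset.sum_congr rfl fun m hm => ?_
  have hmk : m ≤ k := Nat.lt_succ_iff.1 (Finset.mem_range.1 hm)
  have hindex : (k : ℝ) + (α - 1) = (α + m) + ((k - m : ℕ) : ℝ) - 1 := by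
    rw [Nat.cast_sub hmk]; ring
  calc (-1 : ℝ) ^ m * Ring.choose ((k : ℝ) + (α - 1)) (k - m) * (y ^ m / m !) * gammaPDFReal α 1 y
      = (-1 : ℝ) ^ m * ((ascPochhammer ℝ (k - m)).eval (α + m) / (k - m)!) *
          (y ^ m * gammaPDFReal α 1 y) / m ! := by
        rw [hindex, ring_choose_add_eq_ascPochhammer]; ring
    _ = (ascPochhammer ℝ k).eval α / k ! *
          ((-1 : ℝ) ^ m * k.choose m * gammaPDFReal (α + m) 1 y) := by
        rw [pow_mul_gammaPDFReal hα hy, ← Nat.add_sub_cancel' hmk,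
          ← ascPochhammer_eval_mul_eval_add, Nat.add_sub_cancel' hmk, Nat.cast_choose ℝ hmk]
        field_simp

lemma integrableOn_laguerreL_mul_gammaPDFReal {α : ℝ} (hα : 0 < α) (k : ℕ) :
    IntegrableOn (fun y => laguerreL k (α - 1) y * gammaPDFReal α 1 y) (Ioi 0) := by
  rw [integrableOn_congr_fun (fun y hy => laguerreL_mul_gammaPDFReal hα (mem_Ioi.1 hy) k)
    measurableSet_Ioi]
  exact (integrable_finsetSum _ fun m _ =>
    (integrable_gammaPDFReal (by positivity) one_pos).integrableOn.const_mul _).const_mul _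

lemma integrableOn_exp_neg_mul_mul {f : ℝ → ℂ} (hf : IntegrableOn f (Ioi 0)) {z : ℂ}
    (hz : 0 ≤ z.re) : IntegrableOn (fun y : ℝ => Complex.exp (-(z * y)) * f y) (Ioi 0) := by
  refine Integrable.bdd_mul (c := 1) hf (by fun_prop) ?_
  filter_upwards [ae_restrict_mem measurableSet_Ioi] with y hy
  rw [norm_exp_neg_mul_ofReal, Real.exp_le_one_iff, neg_nonpos]
  exact mul_nonneg hz (mem_Ioi.1 hy).le

lemma integral_exp_neg_mul_laguerreL {α : ℝ} (hα : 0 < α) (k : ℕ) {z : ℂ} (hz : 0 ≤ z.re) :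
    ∫ y in Ioi (0 : ℝ), Complex.exp (-(z * y)) *
      ((laguerreL k (α - 1) y * gammaPDFReal α 1 y : ℝ) : ℂ) =
      ((ascPochhammer ℝ k).eval α / k ! : ℝ) * ((1 + z) ^ (-(α : ℂ)) * (z / (1 + z)) ^ k) := by
  have hz1 := one_add_ne_zero_of_re_nonneg hz
  have hexpand : ∀ y ∈ Ioi (0 : ℝ), Complex.exp (-(z * y)) *
      ((laguerreL k (α - 1) y * gammaPDFReal α 1 y : ℝ) : ℂ) =
      ((ascPochhammer ℝ k).eval α / k ! : ℝ) * ∑ m ∈ Finset.range (k + 1),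
        ((-1 : ℂ) ^ m * k.choose m) *
          (Complex.exp (-(z * y)) * (gammaPDFReal (α + m) 1 y : ℂ)) := fun y hy => by
    rw [laguerreL_mul_gammaPDFReal hα hy]
    push_cast
    rw [mul_left_comm, Finset.mul_sum]
    congr 1
    exact Finset.sum_congr rfl fun m _ => by ring
  have hgamma : ∀ m : ℕ, ∫ y in Ioi (0 : ℝ), Complex.exp (-(z * y)) *
      (gammaPDFReal (α + m) 1 y : ℂ) = (1 + z) ^ (-(α : ℂ)) * ((1 + z)⁻¹) ^ m := fun m => by
    rw [integral_exp_neg_mul_gammaPDFReal (by positivity) one_pos (by linarith)]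
    push_cast
    rw [div_one, neg_add, Complex.cpow_add _ _ hz1, Complex.cpow_neg _ (m : ℂ),
      Complex.cpow_natCast, inv_pow]
  rw [setIntegral_congr_fun measurableSet_Ioi hexpand, integral_const_mul, integral_finsetSum]
  swap
  · exact fun m _ => (integrableOn_exp_neg_mul_mul
      (integrable_gammaPDFReal (by positivity) one_pos).ofReal.integrableOn hz).const_mul _
  simp_rw [integral_const_mul, hgamma]
  congr 1
  rw [show z / (1 + z) = -(1 + z)⁻¹ + 1 by field_simp; ring, add_pow, Finset.mul_sum]
  refine Finset.sum_congr rfl fun m _ => ?_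
  rw [neg_pow (1 + z)⁻¹, one_pow]
  ring

/-! ### Central and non-central gamma distribution functions -/

lemma integral_mul_measureReal_Iic {X : Type*} [PartialOrder X] [Zero X] [TopologicalSpace X]
    [OrderClosedTopology X] [SecondCountableTopology X] [MeasurableSpace X] [BorelSpace X]
    {ν vol : Measure X} [IsFiniteMeasure ν] [SigmaFinite vol] (hν : ∀ᵐ y ∂ν, 0 ≤ y)
    {e : X → ℂ} (he : IntegrableOn e (Ici 0) vol) :
    ∫ x, e x * (ν.real (Iic x) : ℂ) ∂vol = ∫ y, (∫ x in Ici y, e x ∂vol) ∂ν := by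
  have hmeas : MeasurableSet {p : X × X | p.2 ≤ p.1} :=
    measurableSet_le measurable_snd measurable_fst
  let f (p : X × X) : ℂ :=
    {p : X × X | p.2 ≤ p.1}.indicator (fun p => (Ici (0 : X)).indicator e p.1 * (1 : ℂ)) p
  have hf : Integrable f (vol.prod ν) :=
    (((integrable_indicator_iff measurableSet_Ici).2 he).mul_prod (integrable_const _)).indicator
      hmeas
  have hfirst : ∀ x y, 0 ≤ y → f (x, y) = (Iic x).indicator (fun _ => e x) y := fun x y hy => by
    by_cases hyx : y ≤ x
    · simp [f, indicator, hyx, hy.trans hyx]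
    · simp [f, indicator, hyx]
  have hsecond : ∀ x y, 0 ≤ y → f (x, y) = (Ici y).indicator e x := fun x y hy => by
    rw [hfirst x y hy]; rfl
  calc ∫ x, e x * (ν.real (Iic x) : ℂ) ∂vol = ∫ x, ∫ y, f (x, y) ∂ν ∂vol := by
        congr 1 with x
        rw [integral_congr_ae (hν.mono (hfirst x)), integral_indicator measurableSet_Iic,
          setIntegral_const, Complex.real_smul, mul_comm]
    _ = ∫ y, ∫ x, f (x, y) ∂vol ∂ν := integral_integral_swap hf
    _ = ∫ y, (∫ x in Ici y, e x ∂vol) ∂ν := by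
        refine integral_congr_ae (hν.mono fun y hy => ?_)
        simp only [hsecond _ y hy]
        exact integral_indicator measurableSet_Ici

lemma integrableOn_exp_neg_mul_Ici {s : ℂ} (hs : 0 < s.re) (c : ℝ) :
    IntegrableOn (fun x : ℝ => Complex.exp (-(s * x))) (Ici c) := by
  rw [integrableOn_Ici_iff_integrableOn_Ioi]
  simpa using integrableOn_exp_mul_complex_Ioi (a := -s) (by simpa using hs) c

lemma integral_exp_neg_mul_Ici {s : ℂ} (hs : 0 < s.re) (c : ℝ) :
    ∫ x in Ici c, Complex.exp (-(s * x)) = s⁻¹ * Complex.exp (-(s * c)) := by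
  have h := integral_exp_mul_complex_Ioi (a := -s) (by simpa using hs) c
  simp only [neg_mul] at h
  rw [integral_Ici_eq_integral_Ioi, h, neg_div_neg_eq, div_eq_inv_mul]

lemma gammaMeasure_ae_nonneg (β r : ℝ) : ∀ᵐ y ∂(gammaMeasure β r), 0 ≤ y := by
  rw [gammaMeasure, ae_withDensity_iff (by unfold gammaPDF; fun_prop)]
  exact ae_of_all _ fun y hy => not_lt.1 fun hneg => hy (gammaPDF_of_neg hneg)

section Cdf

variable {β r : ℝ}

lemma continuous_cdf_gammaMeasure (hβ : 0 < β) (hr : 0 < r) :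
    Continuous (cdf (gammaMeasure β r)) := by
  have hint := integrable_gammaPDFReal hβ hr
  have hcdf : ⇑(cdf (gammaMeasure β r)) = fun x =>
      (∫ t in Iic 0, gammaPDFReal β r t) + ∫ t in (0 : ℝ)..x, gammaPDFReal β r t := by
    ext x
    rw [cdf_gammaMeasure_eq_integral hβ hr,
      ← intervalIntegral.integral_Iic_sub_Iic hint.integrableOn hint.integrableOn]
    ring
  rw [hcdf]
  exact continuous_const.add
    (intervalIntegral.continuous_primitive (fun _ _ => hint.intervalIntegrable) 0)

lemma cdf_gammaMeasure_of_neg (hβ : 0 < β) (hr : 0 < r) {x : ℝ} (hx : x < 0) :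
    cdf (gammaMeasure β r) x = 0 := by
  have := isProbabilityMeasure_gammaMeasure hβ hr
  rw [cdf_eq_real, measureReal_eq_zero_iff]
  exact measure_mono_null (fun y hy => not_le.2 ((mem_Iic.1 hy).trans_lt hx))
    (gammaMeasure_ae_nonneg β r)

lemma integral_exp_neg_mul_cdf_gammaMeasure (hβ : 0 < β) (hr : 0 < r) {s : ℂ} (hs : 0 < s.re) :
    ∫ x : ℝ, Complex.exp (-(s * x)) * (cdf (gammaMeasure β r) x : ℂ) =
      s⁻¹ * (1 + s / r) ^ (-(β : ℂ)) := by
  have := isProbabilityMeasure_gammaMeasure hβ hr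
  simp_rw [cdf_eq_real]
  rw [integral_mul_measureReal_Iic (gammaMeasure_ae_nonneg β r)
    (integrableOn_exp_neg_mul_Ici hs 0)]
  simp_rw [integral_exp_neg_mul_Ici hs]
  rw [integral_const_mul, integral_gammaMeasure hβ hr,
    ← integral_exp_neg_mul_gammaPDFReal hβ hr (by linarith)]
  simp [mul_comm]

end Cdf

section Noncentral

variable {α : ℝ}

lemma norm_cdf_mul_pow_div_factorial_le (μ : Measure ℝ) (x y : ℝ) (m : ℕ) :
    ‖cdf μ x * (y ^ m / (m ! : ℝ))‖ ≤ |y| ^ m / (m ! : ℝ) := by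
  rw [norm_mul, Real.norm_of_nonneg (cdf_nonneg _ _), norm_div, norm_pow, Real.norm_eq_abs,
    Real.norm_natCast]
  exact mul_le_of_le_one_left (by positivity) (cdf_le_one _ _)

lemma summable_cdf_mul_pow_div_factorial (μ : ℕ → Measure ℝ) (x y : ℝ) :
    Summable fun m : ℕ => cdf (μ m) x * (y ^ m / (m ! : ℝ)) :=
  .of_norm_bounded (Real.summable_pow_div_factorial |y|)
    fun m => norm_cdf_mul_pow_div_factorial_le (μ m) x y m

lemma measurable_noncentralGammaCDF (hα : 0 < α) :
    Measurable fun p : ℝ × ℝ => noncentralGammaCDF α p.1 p.2 := by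
  unfold noncentralGammaCDF
  refine Measurable.mul (by fun_prop) ?_
  refine measurable_of_tendsto_metrizable (f := fun N : ℕ => fun p : ℝ × ℝ =>
    ∑ m ∈ Finset.range N, cdf (gammaMeasure (α + m) 1) p.1 * (p.2 ^ m / (m ! : ℝ)))
    (fun N => Finset.measurable_fun_sum _ fun m _ => ?_) ?_
  · have := (continuous_cdf_gammaMeasure (β := α + m) (by positivity) one_pos).measurable
    fun_prop
  · rw [tendsto_pi_nhds]
    exact fun p => (summable_cdf_mul_pow_div_factorial _ p.1 p.2).hasSum.tendsto_sum_nat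

lemma continuous_noncentralGammaCDF (hα : 0 < α) (y : ℝ) :
    Continuous fun x => noncentralGammaCDF α x y := by
  refine continuous_const.mul (continuous_tsum (fun m => ?_) (Real.summable_pow_div_factorial |y|)
    fun m x => norm_cdf_mul_pow_div_factorial_le _ x y m)
  have := continuous_cdf_gammaMeasure (β := α + m) (by positivity) one_pos
  fun_prop

lemma noncentralGammaCDF_of_neg (hα : 0 < α) {x : ℝ} (hx : x < 0) (y : ℝ) :
    noncentralGammaCDF α x y = 0 := by
  have (m : ℕ) : cdf (gammaMeasure (α + m) 1) x = 0 :=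
    cdf_gammaMeasure_of_neg (by positivity) one_pos hx
  simp [noncentralGammaCDF, this]

lemma norm_noncentralGammaCDF_le_one (α x : ℝ) {y : ℝ} (hy : 0 ≤ y) :
    ‖noncentralGammaCDF α x y‖ ≤ 1 := by
  have hexp : HasSum (fun m : ℕ => |y| ^ m / (m ! : ℝ)) (Real.exp y) := by
    rw [abs_of_nonneg hy, Real.exp_eq_exp_ℝ]
    exact NormedSpace.expSeries_div_hasSum_exp y
  rw [noncentralGammaCDF, norm_mul, Real.norm_of_nonneg (Real.exp_pos _).le, Real.exp_neg,
    inv_mul_le_one₀ (Real.exp_pos y)]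
  exact tsum_of_norm_bounded hexp fun m => norm_cdf_mul_pow_div_factorial_le _ x y m

lemma hasSum_integral_exp_neg_mul_noncentralGammaCDF (hα : 0 < α) {s : ℂ} (hs : 0 < s.re)
    (y : ℝ) :
    HasSum (fun m : ℕ => (y ^ m / (m ! : ℝ) : ℂ) *
        ∫ x : ℝ, Complex.exp (-(s * x)) * (cdf (gammaMeasure (α + m) 1) x : ℂ))
      (Complex.exp y * ∫ x : ℝ, Complex.exp (-(s * x)) * (noncentralGammaCDF α x y : ℂ)) := by
  let F (m : ℕ) (x : ℝ) : ℂ := Complex.exp (-(s * x)) *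
    ((cdf (gammaMeasure (α + m) 1) x * (y ^ m / (m ! : ℝ)) : ℝ) : ℂ)
  let e : ℝ → ℝ := (Ici 0).indicator fun x => Real.exp (-(s.re * x))
  have he : Integrable e := (integrable_indicator_iff measurableSet_Ici).2 <| by
    simpa only [IntegrableOn, norm_exp_neg_mul_ofReal] using
      (integrableOn_exp_neg_mul_Ici hs 0).norm
  have hFmeas (m : ℕ) : AEStronglyMeasurable (F m) := by
    have := continuous_cdf_gammaMeasure (β := α + m) (by positivity) one_pos
    have : Continuous (F m) := by fun_prop
    exact this.aestronglyMeasurable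
  have hFle (m : ℕ) (x : ℝ) : ‖F m x‖ ≤ e x * (|y| ^ m / (m ! : ℝ)) := by
    by_cases hx : 0 ≤ x
    · simp only [F, e, norm_mul, norm_exp_neg_mul_ofReal, Complex.norm_real, indicator, mem_Ici, hx,
        if_true]
      rw [← norm_mul]
      exact mul_le_mul_of_nonneg_left (norm_cdf_mul_pow_div_factorial_le _ _ _ _)
        (Real.exp_pos _).le
    · simp [F, e, hx, cdf_gammaMeasure_of_neg (β := α + m) (by positivity) one_pos (not_le.1 hx)]
  have hsum := Real.summable_pow_div_factorial |y|
  have hlim (x : ℝ) : HasSum (fun m => F m x)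
      (Complex.exp (-(s * x)) * (Complex.exp y * (noncentralGammaCDF α x y : ℂ))) := by
    refine HasSum.mul_left _ ?_
    rw [noncentralGammaCDF, ← Complex.ofReal_exp, ← Complex.ofReal_mul, ← mul_assoc,
      ← Real.exp_add, add_neg_cancel, Real.exp_zero, one_mul]
    exact Complex.hasSum_ofReal.2 (summable_cdf_mul_pow_div_factorial _ x y).hasSum
  have hterm (m : ℕ) : ∫ x, F m x = (y ^ m / (m ! : ℝ) : ℂ) *
      ∫ x : ℝ, Complex.exp (-(s * x)) * (cdf (gammaMeasure (α + m) 1) x : ℂ) := by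
    rw [← integral_const_mul]
    congr 1 with x
    simp only [F]
    push_cast
    ring
  have hmain := hasSum_integral_of_dominated_convergence
    (fun m x => e x * (|y| ^ m / (m ! : ℝ))) hFmeas (fun m => ae_of_all _ (hFle m))
    (ae_of_all _ fun x => hsum.mul_left _) (by simpa only [tsum_mul_left] using he.mul_const _)
    (ae_of_all _ hlim)
  simpa only [hterm, mul_left_comm _ (Complex.exp y), integral_const_mul] using hmain

lemma integral_exp_neg_mul_noncentralGammaCDF (hα : 0 < α) {s : ℂ} (hs : 0 < s.re) (y : ℝ) :
    ∫ x : ℝ, Complex.exp (-(s * x)) * (noncentralGammaCDF α x y : ℂ) =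
      s⁻¹ * (1 + s) ^ (-(α : ℂ)) * Complex.exp (-(s / (1 + s) * y)) := by
  have hs1 := one_add_ne_zero_of_re_nonneg hs.le
  have hterm (m : ℕ) : (y ^ m / (m ! : ℝ) : ℂ) *
      ∫ x : ℝ, Complex.exp (-(s * x)) * (cdf (gammaMeasure (α + m) 1) x : ℂ) =
      s⁻¹ * (1 + s) ^ (-(α : ℂ)) * (((y : ℂ) / (1 + s)) ^ m / (m ! : ℂ)) := by
    rw [integral_exp_neg_mul_cdf_gammaMeasure (by positivity) one_pos hs]
    push_cast
    rw [div_one, neg_add, Complex.cpow_add _ _ hs1, Complex.cpow_neg _ (m : ℂ),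
      Complex.cpow_natCast, div_pow]
    field_simp
  have hseries := hasSum_integral_exp_neg_mul_noncentralGammaCDF hα hs y
  simp_rw [hterm] at hseries
  have hexp := (NormedSpace.expSeries_div_hasSum_exp ((y : ℂ) / (1 + s))).mul_left
    (s⁻¹ * (1 + s) ^ (-(α : ℂ)))
  rw [← Complex.exp_eq_exp_ℂ] at hexp
  rw [← mul_right_inj' (Complex.exp_ne_zero y), hseries.unique hexp, mul_left_comm,
    ← Complex.exp_add]
  congr 2
  field_simp
  ring

lemma integral_exp_neg_mul_noncentralGammaCDF_inv_mul (hα : 0 < α) {b : ℝ} (hb : 0 < b) {s : ℂ}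
    (hs : 0 < s.re) (y : ℝ) :
    ∫ x : ℝ, Complex.exp (-(s * x)) * (noncentralGammaCDF α (b⁻¹ * x) (b⁻¹ * y) : ℂ) =
      s⁻¹ * (1 + b * s) ^ (-(α : ℂ)) * Complex.exp (-(s / (1 + b * s) * y)) := by
  have hbs : 0 < ((b : ℂ) * s).re := by simpa using mul_pos hb hs
  have hb' : (b : ℂ) ≠ 0 := by exact_mod_cast hb.ne'
  have hscale := Measure.integral_comp_mul_left
    (fun x : ℝ => Complex.exp (-(b * s * x)) * (noncentralGammaCDF α x (b⁻¹ * y) : ℂ)) b⁻¹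
  rw [integral_exp_neg_mul_noncentralGammaCDF hα hbs, inv_inv, abs_of_pos hb,
    Complex.real_smul] at hscale
  convert hscale using 1
  · congr 1 with x
    push_cast
    field_simp
  · push_cast
    field_simp

end Noncentral

/-! ### Multivariate Laplace transforms on the orthant -/

section Orthant

variable {ι : Type*} [Fintype ι]

/-- The multivariate Laplace transform of a function on `ℝ^ι`; the functions of interest vanish
outside the non-negative orthant. -/
noncomputable def laplaceTransform (f : (ι → ℝ) → ℝ) (s : ι → ℂ) : ℂ :=
  ∫ x : ι → ℝ, (∏ u, Complex.exp (-(s u * x u))) * (f x : ℂ)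

/-- Measurable functions supported in the non-negative orthant which grow at most like
`C exp (c ∑ u, x u)`; their Laplace transform converges for `c < re (s u)`. -/
structure OrthantExpBound (f : (ι → ℝ) → ℝ) (C c : ℝ) : Prop where
  measurable : Measurable f
  eq_zero : ∀ x u, x u < 0 → f x = 0
  norm_le : ∀ x, ‖f x‖ ≤ C * Real.exp (c * ∑ u, x u)

/-- The integrable function `exp (-∑ u, c u * x u)` on the non-negative orthant. -/
noncomputable def orthantExp (c : ι → ℝ) (x : ι → ℝ) : ℝ :=
  ∏ u, (Ici (0 : ℝ)).indicator (fun t => Real.exp (-(c u * t))) (x u)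

lemma integrable_orthantExp {c : ι → ℝ} (hc : ∀ u, 0 < c u) : Integrable (orthantExp c) := by
  refine Integrable.fintype_prod
    (f := fun u => (Ici (0 : ℝ)).indicator fun t => Real.exp (-(c u * t))) fun u => ?_
  rw [integrable_indicator_iff measurableSet_Ici]
  simpa only [IntegrableOn, norm_exp_neg_mul_ofReal, Complex.ofReal_re] using
    (integrableOn_exp_neg_mul_Ici (s := c u) (by simpa using hc u) 0).norm

namespace OrthantExpBound

variable {f : (ι → ℝ) → ℝ} {C c d : ℝ}

lemma nonneg (hf : OrthantExpBound f C c) : 0 ≤ C := by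
  simpa using (norm_nonneg _).trans (hf.norm_le 0)

lemma norm_le_const (hf : OrthantExpBound f C 0) (x : ι → ℝ) : ‖f x‖ ≤ C := by
  simpa using hf.norm_le x

lemma mono (hf : OrthantExpBound f C c) (hcd : c ≤ d) : OrthantExpBound f C d where
  measurable := hf.measurable
  eq_zero := hf.eq_zero
  norm_le x := by
    by_cases hx : ∀ u, 0 ≤ x u
    · refine (hf.norm_le x).trans (mul_le_mul_of_nonneg_left (Real.exp_le_exp.2 ?_) hf.nonneg)
      exact mul_le_mul_of_nonneg_right hcd (Finset.sum_nonneg fun u _ => hx u)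
    · obtain ⟨u, hu⟩ := not_forall.1 hx
      rw [hf.eq_zero x u (not_le.1 hu), norm_zero]
      exact mul_nonneg hf.nonneg (Real.exp_pos _).le

lemma const_mul (hf : OrthantExpBound f C c) (r : ℝ) :
    OrthantExpBound (fun x => r * f x) (|r| * C) c where
  measurable := hf.measurable.const_mul r
  eq_zero x u hx := by rw [hf.eq_zero x u hx, mul_zero]
  norm_le x := by
    rw [norm_mul, Real.norm_eq_abs r, mul_assoc]
    exact mul_le_mul_of_nonneg_left (hf.norm_le x) (abs_nonneg r)

lemma sum {β : Type*} {S : Finset β} {f : β → (ι → ℝ) → ℝ} {C : β → ℝ}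
    (hf : ∀ i ∈ S, OrthantExpBound (f i) (C i) c) :
    OrthantExpBound (fun x => ∑ i ∈ S, f i x) (∑ i ∈ S, C i) c where
  measurable := Finset.measurable_fun_sum _ fun i hi => (hf i hi).measurable
  eq_zero x u hx := Finset.sum_eq_zero fun i hi => (hf i hi).eq_zero x u hx
  norm_le x := by
    rw [Finset.sum_mul]
    exact (norm_sum_le _ _).trans (Finset.sum_le_sum fun i hi => (hf i hi).norm_le x)

lemma norm_kernel_mul_le (hf : OrthantExpBound f C c) (s : ι → ℂ) (x : ι → ℝ) :
    ‖(∏ u, Complex.exp (-(s u * x u))) * (f x : ℂ)‖ ≤ orthantExp (fun u => (s u).re - c) x * C := by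
  by_cases hx : ∀ u, 0 ≤ x u
  · simp only [orthantExp, norm_mul, norm_prod, norm_exp_neg_mul_ofReal, Complex.norm_real,
      indicator, mem_Ici, hx, if_true]
    refine (mul_le_mul_of_nonneg_left (hf.norm_le x)
      (Finset.prod_nonneg fun _ _ => (Real.exp_pos _).le)).trans_eq ?_
    rw [Finset.mul_sum, Real.exp_sum, mul_left_comm, mul_comm C, ← Finset.prod_mul_distrib]
    congr 1
    refine Finset.prod_congr rfl fun u _ => ?_
    rw [← Real.exp_add]
    congr 1
    ring
  · obtain ⟨u, hu⟩ := not_forall.1 hx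
    have : orthantExp (fun u => (s u).re - c) x = 0 :=
      Finset.prod_eq_zero (Finset.mem_univ u) (by simp [hu])
    simp [hf.eq_zero x u (not_le.1 hu), this]

lemma aestronglyMeasurable_kernel_mul (hf : OrthantExpBound f C c) (s : ι → ℂ) :
    AEStronglyMeasurable fun x : ι → ℝ => (∏ u, Complex.exp (-(s u * x u))) * (f x : ℂ) := by
  have := hf.measurable
  exact Measurable.aestronglyMeasurable (by fun_prop)

lemma integrable_kernel_mul (hf : OrthantExpBound f C c) {s : ι → ℂ} (hs : ∀ u, c < (s u).re) :
    Integrable fun x : ι → ℝ => (∏ u, Complex.exp (-(s u * x u))) * (f x : ℂ) :=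
  ((integrable_orthantExp fun u => sub_pos.2 (hs u)).mul_const C).mono'
    (hf.aestronglyMeasurable_kernel_mul s) (ae_of_all _ (hf.norm_kernel_mul_le s))

end OrthantExpBound

lemma laplaceTransform_const_mul (r : ℝ) (f : (ι → ℝ) → ℝ) (s : ι → ℂ) :
    laplaceTransform (fun x => r * f x) s = r * laplaceTransform f s := by
  simp only [laplaceTransform, Complex.ofReal_mul, mul_left_comm _ (r : ℂ), integral_const_mul]

lemma laplaceTransform_sum {β : Type*} {S : Finset β} {f : β → (ι → ℝ) → ℝ} {C : β → ℝ} {c : ℝ}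
    (hf : ∀ i ∈ S, OrthantExpBound (f i) (C i) c) {s : ι → ℂ} (hs : ∀ u, c < (s u).re) :
    laplaceTransform (fun x => ∑ i ∈ S, f i x) s = ∑ i ∈ S, laplaceTransform (f i) s := by
  simp only [laplaceTransform, Complex.ofReal_sum, Finset.mul_sum]
  exact integral_finsetSum _ fun i hi => (hf i hi).integrable_kernel_mul hs

section Tsum

variable {f : ℕ → (ι → ℝ) → ℝ} {C : ℕ → ℝ} {c : ℝ}

lemma OrthantExpBound.summable (hf : ∀ k, OrthantExpBound (f k) (C k) c) (hC : Summable C)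
    (x : ι → ℝ) : Summable fun k => f k x :=
  .of_norm_bounded (hC.mul_right _) fun k => (hf k).norm_le x

lemma OrthantExpBound.tsum (hf : ∀ k, OrthantExpBound (f k) (C k) c) (hC : Summable C) :
    OrthantExpBound (fun x => ∑' k, f k x) (∑' k, C k) c where
  measurable := measurable_of_tendsto_metrizable
    (f := fun N x => ∑ k ∈ Finset.range N, f k x)
    (fun N => Finset.measurable_fun_sum _ fun k _ => (hf k).measurable)
    (tendsto_pi_nhds.2 fun x => (OrthantExpBound.summable hf hC x).hasSum.tendsto_sum_nat)
  eq_zero x u hx := by simp [fun k => (hf k).eq_zero x u hx]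
  norm_le x := tsum_of_norm_bounded (hC.hasSum.mul_right _) fun k => (hf k).norm_le x

lemma OrthantExpBound.continuous_tsum (hf : ∀ k, OrthantExpBound (f k) (C k) c) (hC : Summable C)
    (hcont : ∀ k, Continuous (f k)) : Continuous fun x => ∑' k, f k x := by
  refine continuous_iff_continuousAt.2 fun x => ?_
  let U : Set (ι → ℝ) := {y | c * ∑ u, y u < c * ∑ u, x u + 1}
  have hU : U ∈ 𝓝 x :=
    (isOpen_lt (by fun_prop) continuous_const).mem_nhds (lt_add_one (c * ∑ u, x u))
  refine (continuousOn_tsum (fun k => (hcont k).continuousOn)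
    (hC.mul_right (Real.exp (c * ∑ u, x u + 1))) fun k y (hy : y ∈ U) => ?_).continuousAt hU
  exact ((hf k).norm_le y).trans
    (mul_le_mul_of_nonneg_left (Real.exp_le_exp.2 (le_of_lt hy)) (hf k).nonneg)

lemma hasSum_laplaceTransform_tsum (hf : ∀ k, OrthantExpBound (f k) (C k) c) (hC : Summable C)
    {s : ι → ℂ} (hs : ∀ u, c < (s u).re) :
    HasSum (fun k => laplaceTransform (f k) s) (laplaceTransform (fun x => ∑' k, f k x) s) := by
  refine hasSum_integral_of_dominated_convergence
    (fun k x => orthantExp (fun u => (s u).re - c) x * C k)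
    (fun k => (hf k).aestronglyMeasurable_kernel_mul s)
    (fun k => ae_of_all _ ((hf k).norm_kernel_mul_le s))
    (ae_of_all _ fun x => hC.mul_left _) ?_ (ae_of_all _ fun x => ?_)
  · simp only [tsum_mul_left]
    exact (integrable_orthantExp fun u => sub_pos.2 (hs u)).mul_const _
  · exact (Complex.hasSum_ofReal.2 (OrthantExpBound.summable hf hC x).hasSum).mul_left _

end Tsum

end Orthant

section Sigma

variable {ι : Type*} [Fintype ι] {κ : ι → Type*} [∀ j, Fintype (κ j)]

lemma measurePreserving_piCurry_symm {X : (j : ι) → κ j → Type*}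
    [∀ j i, MeasureSpace (X j i)] [∀ j i, SigmaFinite (volume : Measure (X j i))] :
    MeasurePreserving (MeasurableEquiv.piCurry X).symm := by
  refine ⟨(MeasurableEquiv.piCurry X).symm.measurable, (Measure.pi_eq fun s _ => ?_).symm⟩
  have hbox : (MeasurableEquiv.piCurry X).symm ⁻¹' univ.pi s =
      univ.pi fun j => univ.pi fun i => s ⟨j, i⟩ := by
    ext x
    simp [MeasurableEquiv.coe_piCurry_symm, Sigma.forall, Sigma.uncurry]
  rw [(MeasurableEquiv.piCurry X).symm.map_apply, hbox, volume_pi_pi, Fintype.prod_sigma]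
  simp only [volume_pi_pi]

lemma integral_sigma_prod (f : (j : ι) → (κ j → ℝ) → ℂ) :
    ∫ x : ((j : ι) × κ j) → ℝ, ∏ j, f j (fun i => x ⟨j, i⟩) = ∏ j, ∫ y, f j y := by
  rw [← integral_fintype_prod_volume_eq_prod, ← (measurePreserving_piCurry_symm
    (X := fun (j : ι) (_ : κ j) => ℝ)).integral_comp']
  rfl

lemma laplaceTransform_sigma_prod (f : (j : ι) → (κ j → ℝ) → ℝ) (s : ((j : ι) × κ j) → ℂ) :
    laplaceTransform (fun x => ∏ j, f j fun i => x ⟨j, i⟩) s =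
      ∏ j, laplaceTransform (f j) fun i => s ⟨j, i⟩ := by
  simp only [laplaceTransform]
  rw [← integral_sigma_prod]
  congr 1 with x
  rw [Fintype.prod_sigma, Complex.ofReal_prod, Finset.prod_mul_distrib]

lemma OrthantExpBound.sigma_prod {f : (j : ι) → (κ j → ℝ) → ℝ} {C : ι → ℝ} {c : ℝ}
    (hf : ∀ j, OrthantExpBound (f j) (C j) c) :
    OrthantExpBound (fun x : ((j : ι) × κ j) → ℝ => ∏ j, f j fun i => x ⟨j, i⟩) (∏ j, C j) c where
  measurable := Finset.measurable_fun_prod _ fun j _ => (hf j).measurable.comp (by fun_prop)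
  eq_zero x u hx := Finset.prod_eq_zero (Finset.mem_univ u.1) ((hf u.1).eq_zero _ u.2 hx)
  norm_le x := by
    rw [norm_prod, Fintype.sum_sigma, Finset.mul_sum, Real.exp_sum, ← Finset.prod_mul_distrib]
    exact Finset.prod_le_prod (fun _ _ => norm_nonneg _) fun j _ => (hf j).norm_le _

end Sigma

section Mixture

variable {ι : Type*} [Fintype ι] {Y : Type*} [MeasurableSpace Y] {ν : Measure Y}
  {P : Y → (ι → ℝ) → ℝ} {w : Y → ℝ} {C c : ℝ}

lemma OrthantExpBound.integral_mul [SFinite ν] (hP : ∀ᵐ y ∂ν, OrthantExpBound (P y) C c)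
    (hPm : Measurable (Function.uncurry P)) (hwm : Measurable w) (hw : Integrable w ν) :
    OrthantExpBound (fun x => ∫ y, P y x * w y ∂ν) (C * ∫ y, ‖w y‖ ∂ν) c where
  measurable := by
    have : Measurable fun q : (ι → ℝ) × Y => P q.2 q.1 * w q.2 :=
      (hPm.comp measurable_swap).mul (hwm.comp measurable_snd)
    exact this.stronglyMeasurable.integral_prod_right.measurable
  eq_zero x u hx := integral_eq_zero_of_ae <| hP.mono fun y hy => by
    simp [hy.eq_zero x u hx]
  norm_le x := by
    rw [mul_right_comm, ← integral_const_mul]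
    refine norm_integral_le_of_norm_le (hw.norm.const_mul _) (hP.mono fun y hy => ?_)
    rw [norm_mul]
    exact mul_le_mul_of_nonneg_right (hy.norm_le x) (norm_nonneg _)

lemma continuous_integral_mul_of_orthantExpBound (hP : ∀ᵐ y ∂ν, OrthantExpBound (P y) C 0)
    (hPm : Measurable (Function.uncurry P)) (hwm : Measurable w) (hw : Integrable w ν)
    (hcont : ∀ y, Continuous (P y)) : Continuous fun x => ∫ y, P y x * w y ∂ν := by
  refine continuous_of_dominated (bound := fun y => C * ‖w y‖) (fun x => ?_) (fun x => ?_)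
    (hw.norm.const_mul C) (ae_of_all _ fun y => (hcont y).mul_const _)
  · exact ((hPm.comp (measurable_id.prodMk measurable_const)).mul hwm).aestronglyMeasurable
  · refine hP.mono fun y hy => ?_
    rw [norm_mul]
    exact mul_le_mul_of_nonneg_right (hy.norm_le_const x) (norm_nonneg _)

lemma laplaceTransform_integral_mul [SFinite ν] (hP : ∀ᵐ y ∂ν, OrthantExpBound (P y) C c)
    (hPm : Measurable (Function.uncurry P)) (hwm : Measurable w) (hw : Integrable w ν)
    {s : ι → ℂ} (hs : ∀ u, c < (s u).re) :
    laplaceTransform (fun x => ∫ y, P y x * w y ∂ν) s =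
      ∫ y, laplaceTransform (P y) s * w y ∂ν := by
  have hint : Integrable (Function.uncurry fun (x : ι → ℝ) y =>
      (∏ u, Complex.exp (-(s u * x u))) * (P y x : ℂ) * w y) (volume.prod ν) := by
    refine (((integrable_orthantExp fun u => sub_pos.2 (hs u)).mul_const C).mul_prod
      hw.norm).mono' ?_ ?_
    · have : Measurable fun q : (ι → ℝ) × Y => P q.2 q.1 := hPm.comp measurable_swap
      exact Measurable.aestronglyMeasurable (by simp only [Function.uncurry_def]; fun_prop)
    · refine (Measure.quasiMeasurePreserving_snd.ae hP).mono fun q hq => ?_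
      rw [Function.uncurry, norm_mul, Complex.norm_real]
      exact mul_le_mul_of_nonneg_right (hq.norm_kernel_mul_le s q.1) (norm_nonneg _)
  simp only [laplaceTransform, ← integral_mul_const]
  rw [← integral_integral_swap hint]
  refine integral_congr_ae (ae_of_all _ fun x => ?_)
  simp only [mul_assoc, integral_const_mul, ← Complex.ofReal_mul, integral_complex_ofReal]

end Mixture

/-! ### Discs on a diameter `[0, d]` -/

/-- The closed disc having the real segment `[0, d]` as a diameter. The circle bounding
`diameterDisc (blockRadius a)` is the one traced by `circlePoint a`. -/
def diameterDisc (d : ℝ) : Set ℂ :=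
  Metric.closedBall ((d / 2 : ℝ) : ℂ) (d / 2)

section Disc

variable {d : ℝ} {z : ℂ}

lemma mem_diameterDisc_iff (hd : 0 ≤ d) :
    z ∈ diameterDisc d ↔ Complex.normSq z ≤ d * z.re := by
  rw [diameterDisc, mem_closedBall_iff_norm, ← sq_le_sq₀ (norm_nonneg _) (by positivity),
    ← Complex.normSq_eq_norm_sq, Complex.normSq_apply, Complex.normSq_apply]
  simp only [Complex.sub_re, Complex.sub_im, Complex.ofReal_re, Complex.ofReal_im]
  constructor <;> intro h <;> linarith

lemma re_nonneg_of_mem_diameterDisc (hz : z ∈ diameterDisc d) : 0 ≤ z.re := by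
  have h := (Complex.abs_re_le_norm _).trans (mem_closedBall_iff_norm.1 hz)
  rw [Complex.sub_re, Complex.ofReal_re] at h
  linarith [(abs_le.1 h).1]

lemma smul_mem_diameterDisc {c : ℝ} (hc : 0 ≤ c) (hz : z ∈ diameterDisc d) :
    c • z ∈ diameterDisc (c * d) := by
  rw [diameterDisc, mem_closedBall_iff_norm] at hz ⊢
  have h := mul_le_mul_of_nonneg_left hz hc
  rw [← Real.norm_of_nonneg hc, ← norm_smul, Real.norm_of_nonneg hc, smul_sub] at h
  rwa [mul_div_assoc, Complex.ofReal_mul, ← Complex.real_smul]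

lemma sum_mem_diameterDisc {β : Type*} {S : Finset β} {d : β → ℝ} {z : β → ℂ}
    (hz : ∀ i ∈ S, z i ∈ diameterDisc (d i)) : ∑ i ∈ S, z i ∈ diameterDisc (∑ i ∈ S, d i) := by
  simp only [diameterDisc, mem_closedBall_iff_norm] at hz ⊢
  rw [Finset.sum_div, Complex.ofReal_sum, ← Finset.sum_sub_distrib]
  exact norm_sum_le_of_le S hz

lemma div_one_add_smul_mem_diameterDisc {b : ℝ} (hb : 0 < b) (hz : 0 ≤ z.re) :
    z / (1 + b • z) ∈ diameterDisc b⁻¹ := by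
  rw [mem_diameterDisc_iff (inv_pos.2 hb).le, Complex.normSq_div, Complex.div_re, ← add_div,
    mul_div_assoc']
  refine div_le_div_of_nonneg_right ?_ (Complex.normSq_nonneg _)
  rw [← div_eq_inv_mul, le_div_iff₀ hb, Complex.normSq_apply]
  simp only [Complex.add_re, Complex.one_re, Complex.smul_re, Complex.smul_im, smul_eq_mul,
    Complex.add_im, Complex.one_im]
  linarith

lemma div_one_add_mem_diameterDisc (hd : 0 ≤ d) (hz : z ∈ diameterDisc d) :
    z / (1 + z) ∈ diameterDisc (d / (1 + d)) := by
  rw [mem_diameterDisc_iff (by positivity), Complex.normSq_div, Complex.div_re, ← add_div,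
    mul_div_assoc']
  refine div_le_div_of_nonneg_right ?_ (Complex.normSq_nonneg _)
  rw [div_mul_eq_mul_div, le_div_iff₀ (by positivity)]
  have h := (mem_diameterDisc_iff hd).1 hz
  rw [Complex.normSq_apply] at h ⊢
  simp only [Complex.add_re, Complex.one_re, Complex.add_im, Complex.one_im]
  linarith

end Disc

/-! ### One block -/

/-- `∑ i, a i ^ 2 * s i / (1 + (1 - a i ^ 2) * s i)` for one block with factor `a`, with real or
complex `s`: conditionally on the mixing variable `y`, the Laplace transform of the block depends on
`y` through `exp (-blockShift a s * y)`. -/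
noncomputable def blockShift {K : Type*} [Field K] [Algebra ℝ K] {m : ℕ} (a : Fin m → ℝ)
    (s : Fin m → K) : K :=
  ∑ i, a i ^ 2 • (s i / (1 + (1 - a i ^ 2) • s i))

/-- `blockShift a s / (1 + blockShift a s)`, whose `k`-th power is the contribution of the `k`-th
Laguerre polynomial to the Laplace transform. -/
noncomputable def blockRatio {K : Type*} [Field K] [Algebra ℝ K] {m : ℕ} (a : Fin m → ℝ)
    (s : Fin m → K) : K :=
  blockShift a s / (1 + blockShift a s)

/-- The Laplace transform of the joint cdf of one block with factor `a`. -/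
noncomputable def blockTransform (α : ℝ) {m : ℕ} (a : Fin m → ℝ) (s : Fin m → ℂ) : ℂ :=
  (∏ i, (s i)⁻¹ * (1 + (1 - a i ^ 2) • s i) ^ (-(α : ℂ))) * (1 + blockShift a s) ^ (-(α : ℂ))

lemma one_sub_sq_pos {r : ℝ} (hr : |r| < 1) : 0 < 1 - r ^ 2 :=
  sub_pos.2 ((sq_lt_one_iff_abs_lt_one r).2 hr)

lemma sum_sq_div_one_sub_sq_nonneg {m : ℕ} {a : Fin m → ℝ} (ha : ∀ i, |a i| < 1) :
    0 ≤ ∑ i, a i ^ 2 / (1 - a i ^ 2) :=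
  Finset.sum_nonneg fun i _ => div_nonneg (sq_nonneg _) (one_sub_sq_pos (ha i)).le

section Block

variable {m : ℕ} {a : Fin m → ℝ}

lemma blockShift_mem_diameterDisc (ha : ∀ i, |a i| < 1) {s : Fin m → ℂ} (hs : ∀ i, 0 ≤ (s i).re) :
    blockShift a s ∈ diameterDisc (∑ i, a i ^ 2 / (1 - a i ^ 2)) :=
  sum_mem_diameterDisc fun i _ => smul_mem_diameterDisc (sq_nonneg _)
    (div_one_add_smul_mem_diameterDisc (one_sub_sq_pos (ha i)) (hs i))

lemma blockRatio_mem_diameterDisc (ha : ∀ i, |a i| < 1) {s : Fin m → ℂ}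
    (hs : ∀ i, 0 ≤ (s i).re) :
    blockRatio a s ∈ diameterDisc (blockRadius a) :=
  div_one_add_mem_diameterDisc (sum_sq_div_one_sub_sq_nonneg ha)
    (blockShift_mem_diameterDisc ha hs)

/-- The joint cdf at `x` of one block with factor `a`, conditionally on the value `y` of its mixing
variable. -/
noncomputable def conditionalBlockCDF (α : ℝ) (a : Fin m → ℝ) (y : ℝ) (x : Fin m → ℝ) : ℝ :=
  ∏ i, noncentralGammaCDF α ((1 - a i ^ 2)⁻¹ * x i) ((1 - a i ^ 2)⁻¹ * a i ^ 2 * y)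

lemma measurable_conditionalBlockCDF {α : ℝ} (hα : 0 < α) (a : Fin m → ℝ) :
    Measurable (Function.uncurry (conditionalBlockCDF α a)) := by
  simp only [Function.uncurry_def, conditionalBlockCDF]
  exact Finset.measurable_fun_prod _ fun i _ => (measurable_noncentralGammaCDF hα).comp
    (f := fun q : ℝ × (Fin m → ℝ) => ((1 - a i ^ 2)⁻¹ * q.2 i, (1 - a i ^ 2)⁻¹ * a i ^ 2 * q.1))
    (by fun_prop)

lemma continuous_conditionalBlockCDF {α : ℝ} (hα : 0 < α) (a : Fin m → ℝ) (y : ℝ) :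
    Continuous (conditionalBlockCDF α a y) :=
  continuous_finsetProd _ fun i _ => (continuous_noncentralGammaCDF hα _).comp (by fun_prop)

lemma orthantExpBound_conditionalBlockCDF {α : ℝ} (hα : 0 < α) (ha : ∀ i, |a i| < 1) {y : ℝ}
    (hy : 0 ≤ y) : OrthantExpBound (conditionalBlockCDF α a y) 1 0 where
  measurable := (continuous_conditionalBlockCDF hα a y).measurable
  eq_zero x i hx := Finset.prod_eq_zero (Finset.mem_univ i) (noncentralGammaCDF_of_neg hα
    (mul_neg_of_pos_of_neg (inv_pos.2 (one_sub_sq_pos (ha i))) hx) _)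
  norm_le x := by
    rw [zero_mul, Real.exp_zero, mul_one, conditionalBlockCDF, norm_prod]
    refine Finset.prod_le_one (fun _ _ => norm_nonneg _) fun i _ =>
      norm_noncentralGammaCDF_le_one α _ ?_
    have := one_sub_sq_pos (ha i)
    positivity

lemma laplaceTransform_conditionalBlockCDF {α : ℝ} (hα : 0 < α) (ha : ∀ i, |a i| < 1)
    {s : Fin m → ℂ} (hs : ∀ i, 0 < (s i).re) (y : ℝ) :
    laplaceTransform (conditionalBlockCDF α a y) s =
      (∏ i, (s i)⁻¹ * (1 + (1 - a i ^ 2) • s i) ^ (-(α : ℂ))) *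
        Complex.exp (-(blockShift a s * y)) := by
  simp only [laplaceTransform, conditionalBlockCDF, Complex.ofReal_prod, ← Finset.prod_mul_distrib]
  rw [integral_fintype_prod_volume_eq_prod (fun i (t : ℝ) => Complex.exp (-(s i * t)) *
    (noncentralGammaCDF α ((1 - a i ^ 2)⁻¹ * t) ((1 - a i ^ 2)⁻¹ * a i ^ 2 * y) : ℂ)),
    blockShift, Finset.sum_mul, ← Finset.sum_neg_distrib, Complex.exp_sum,
    ← Finset.prod_mul_distrib]
  refine Finset.prod_congr rfl fun i _ => ?_
  rw [mul_assoc (1 - a i ^ 2)⁻¹, integral_exp_neg_mul_noncentralGammaCDF_inv_mul hα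
    (one_sub_sq_pos (ha i)) (hs i)]
  simp only [Complex.real_smul]
  congr 3
  push_cast
  ring

lemma measurable_laguerreL_mul_gammaPDFReal (k : ℕ) (β α r : ℝ) :
    Measurable fun y => laguerreL k β y * gammaPDFReal α r y := by
  unfold laguerreL
  fun_prop

lemma ae_orthantExpBound_conditionalBlockCDF {α : ℝ} (hα : 0 < α) (ha : ∀ i, |a i| < 1) :
    ∀ᵐ y ∂volume.restrict (Ioi (0 : ℝ)), OrthantExpBound (conditionalBlockCDF α a y) 1 0 :=
  (ae_restrict_mem measurableSet_Ioi).mono fun _ hy =>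
    orthantExpBound_conditionalBlockCDF hα ha (le_of_lt hy)

lemma laguerreCoeff_eq_integral_conditionalBlockCDF (k : ℕ) (x : Fin m → ℝ) (α : ℝ)
    (a : Fin m → ℝ) :
    laguerreCoeff k x α a = ((ascPochhammer ℝ k).eval α / k !)⁻¹ * ∫ y in Ioi (0 : ℝ),
      conditionalBlockCDF α a y x * (laguerreL k (α - 1) y * gammaPDFReal α 1 y) := by
  simp only [laguerreCoeff, ring_choose_add_eq_ascPochhammer, conditionalBlockCDF, mul_assoc]

lemma continuous_laguerreCoeff {α : ℝ} (hα : 0 < α) (ha : ∀ i, |a i| < 1) (k : ℕ) :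
    Continuous fun x => laguerreCoeff k x α a := by
  simp only [laguerreCoeff_eq_integral_conditionalBlockCDF]
  exact (continuous_integral_mul_of_orthantExpBound
    (ae_orthantExpBound_conditionalBlockCDF hα ha) (measurable_conditionalBlockCDF hα a)
    (measurable_laguerreL_mul_gammaPDFReal k _ _ _) (integrableOn_laguerreL_mul_gammaPDFReal hα k)
    (continuous_conditionalBlockCDF hα a)).const_mul _

lemma exists_orthantExpBound_laguerreCoeff {α : ℝ} (hα : 0 < α) (ha : ∀ i, |a i| < 1) (k : ℕ) :
    ∃ C, OrthantExpBound (fun x => laguerreCoeff k x α a) C 0 := by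
  simp only [laguerreCoeff_eq_integral_conditionalBlockCDF]
  exact ⟨_, (OrthantExpBound.integral_mul (ae_orthantExpBound_conditionalBlockCDF hα ha)
    (measurable_conditionalBlockCDF hα a) (measurable_laguerreL_mul_gammaPDFReal k _ _ _)
    (integrableOn_laguerreL_mul_gammaPDFReal hα k)).const_mul _⟩

lemma laplaceTransform_laguerreCoeff {α : ℝ} (hα : 0 < α) (ha : ∀ i, |a i| < 1) (k : ℕ)
    {s : Fin m → ℂ} (hs : ∀ i, 0 < (s i).re) :
    laplaceTransform (fun x => laguerreCoeff k x α a) s =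
      blockTransform α a s * blockRatio a s ^ k := by
  have hcoeff : ((((ascPochhammer ℝ k).eval α / k ! : ℝ)) : ℂ) ≠ 0 := by
    have := ascPochhammer_pos k α hα
    exact_mod_cast (by positivity : (0 : ℝ) < (ascPochhammer ℝ k).eval α / k !).ne'
  simp only [laguerreCoeff_eq_integral_conditionalBlockCDF]
  rw [laplaceTransform_const_mul, laplaceTransform_integral_mul
    (ae_orthantExpBound_conditionalBlockCDF hα ha) (measurable_conditionalBlockCDF hα a)
    (measurable_laguerreL_mul_gammaPDFReal k _ _ _) (integrableOn_laguerreL_mul_gammaPDFReal hα k)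
    hs]
  simp only [laplaceTransform_conditionalBlockCDF hα ha hs, mul_assoc, integral_const_mul]
  rw [integral_exp_neg_mul_laguerreL hα k
    (re_nonneg_of_mem_diameterDisc (blockShift_mem_diameterDisc ha fun i => (hs i).le)),
    mul_left_comm, Complex.ofReal_inv, inv_mul_cancel_left₀ hcoeff, ← mul_assoc]
  rfl

end Block

/-! ### The terms of the series -/

/-- The polynomial `t₁² u₂ u₃ + t₂² u₁ u₃ + t₃² u₁ u₂ - 2 t₁ t₂ t₃ u₁ u₂ u₃`, whose value at
`t = oppositeCorr Θ` and `u = ζ` has the squared modulus `ρ²`. -/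
def corrPoly {K : Type*} [CommRing K] (t u : Fin 3 → K) : K :=
  ∑ j, t j ^ 2 * u (j + 1) * u (j + 2) - 2 * ∏ j, (t j * u j)

lemma prod_pow_eq_prod_pow_sub {K : Type*} [CommRing K] (t u : Fin 3 → K) {κ : Fin 4 → ℕ} {k : ℕ}
    (hκ : ∑ i, κ i = k) :
    (∏ j : Fin 3, (t j ^ 2 * u (j + 1) * u (j + 2)) ^ κ j.castSucc) * (∏ j, (t j * u j)) ^ κ 3 =
      ∏ j : Fin 3, (t j ^ (2 * κ j.castSucc + κ 3) * u j ^ (k - κ j.castSucc)) := by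
  have hsub : ∀ j : Fin 3,
      k - κ j.castSucc = κ (j + 1).castSucc + κ (j + 2).castSucc + κ 3 := by
    rw [Fin.sum_univ_four] at hκ
    intro j
    fin_cases j <;> simp <;> omega
  simp only [hsub, Fin.prod_univ_three]
  simp only [mul_pow, pow_add, pow_mul, Fin.isValue, zero_add, show (1 : Fin 3) + 1 = 2 from rfl,
    show (2 : Fin 3) + 1 = 0 from rfl, show (1 : Fin 3) + 2 = 0 from rfl,
    show (2 : Fin 3) + 2 = 1 from rfl]
  ring

lemma sum_antidiagonalTuple_eq_corrPoly_pow {K : Type*} [Field K] [CharZero K] (t u : Fin 3 → K)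
    (k : ℕ) :
    ∑ κ ∈ Finset.Nat.antidiagonalTuple 4 k, (-2) ^ κ 3 / ((κ 3)! : K) *
      ∏ j : Fin 3, (t j ^ (2 * κ j.castSucc + κ 3) / ((κ j.castSucc)! : K) *
        u j ^ (k - κ j.castSucc)) = corrPoly t u ^ k / k ! := by
  let f : Fin 4 → K := Fin.snoc (fun j : Fin 3 => t j ^ 2 * u (j + 1) * u (j + 2))
    (-2 * ∏ j, (t j * u j))
  have hf : corrPoly t u = ∑ i, f i := by
    rw [Fin.sum_univ_castSucc]
    simp only [f, Fin.snoc_castSucc, Fin.snoc_last, corrPoly]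
    ring
  have hpi : Finset.Nat.antidiagonalTuple 4 k = Finset.piAntidiag Finset.univ k := by
    ext κ
    simp [Finset.Nat.mem_antidiagonalTuple]
  rw [hf, Finset.sum_pow_eq_sum_piAntidiag, hpi, Finset.sum_div]
  refine Finset.sum_congr rfl fun κ hκ => ?_
  have hsum : ∑ i, κ i = k := (Finset.mem_piAntidiag.1 hκ).1
  have hmult : (∏ i, ((κ i)! : K)) * Nat.multinomial Finset.univ κ = k ! := by
    rw [← hsum]
    exact_mod_cast Nat.multinomial_spec Finset.univ κ
  have hk : (k ! : K) ≠ 0 := by exact_mod_cast k.factorial_ne_zero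
  have hmult' : (Nat.multinomial Finset.univ κ : K) / k ! = (∏ i, ((κ i)! : K))⁻¹ := by
    rw [← hmult] at hk ⊢
    rw [div_eq_iff hk, inv_mul_cancel_left₀ (left_ne_zero_of_mul hk)]
  rw [mul_div_right_comm, hmult', Fin.prod_univ_castSucc fun i => f i ^ κ i,
    Fin.prod_univ_castSucc fun i : Fin 4 => ((κ i)! : K)]
  simp only [f, Fin.snoc_castSucc, Fin.snoc_last, mul_pow (-2 : K), div_mul_eq_mul_div,
    Finset.prod_div_distrib]
  rw [← prod_pow_eq_prod_pow_sub t u hsum]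
  simp only [show Fin.last 3 = (3 : Fin 4) from rfl, div_eq_mul_inv, mul_inv]
  ring

section Term

variable {n : Fin 3 → ℕ} {α : ℝ} {a : (j : Fin 3) → Fin (n j) → ℝ}

lemma gammaSeriesTerm_eq_sum_mul_prod_laguerreCoeff (α : ℝ) (Θ : Matrix (Fin 3) (Fin 3) ℝ)
    (a : (j : Fin 3) → Fin (n j) → ℝ) (x : ((j : Fin 3) × Fin (n j)) → ℝ) (k : ℕ) :
    gammaSeriesTerm α Θ a x k = ∑ κ ∈ Finset.Nat.antidiagonalTuple 4 k,
      (ascPochhammer ℝ k).eval α * ((-2) ^ κ 3 / (κ 3)! *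
        ∏ j : Fin 3, (oppositeCorr Θ j ^ (2 * κ j.castSucc + κ 3) / (κ j.castSucc)!)) *
        ∏ j, laguerreCoeff (k - κ j.castSucc) (fun i => x ⟨j, i⟩) α (a j) := by
  simp only [gammaSeriesTerm, Finset.prod_mul_distrib, mul_assoc]

lemma continuous_gammaSeriesTerm (hα : 0 < α) (Θ : Matrix (Fin 3) (Fin 3) ℝ)
    (ha : ∀ j i, |a j i| < 1) (k : ℕ) : Continuous fun x => gammaSeriesTerm α Θ a x k := by
  simp only [gammaSeriesTerm]
  refine continuous_finsetSum _ fun κ _ => continuous_const.mul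
    (continuous_finsetProd _ fun j _ => continuous_const.mul ?_)
  exact (continuous_laguerreCoeff hα (ha j) _).comp (by fun_prop)

lemma exists_orthantExpBound_prod_laguerreCoeff (hα : 0 < α) (ha : ∀ j i, |a j i| < 1)
    (k : Fin 3 → ℕ) : ∃ C, OrthantExpBound (fun x : ((j : Fin 3) × Fin (n j)) → ℝ =>
      ∏ j, laguerreCoeff (k j) (fun i => x ⟨j, i⟩) α (a j)) C 0 := by
  choose C hC using fun j => exists_orthantExpBound_laguerreCoeff hα (ha j) (k j)
  exact ⟨_, OrthantExpBound.sigma_prod hC⟩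

lemma exists_orthantExpBound_gammaSeriesTerm (hα : 0 < α) (Θ : Matrix (Fin 3) (Fin 3) ℝ)
    (ha : ∀ j i, |a j i| < 1) (k : ℕ) :
    ∃ C, OrthantExpBound (fun x => gammaSeriesTerm α Θ a x k) C 0 := by
  simp only [gammaSeriesTerm_eq_sum_mul_prod_laguerreCoeff]
  choose C hC using exists_orthantExpBound_prod_laguerreCoeff hα ha
  exact ⟨_, OrthantExpBound.sum fun κ _ => (hC _).const_mul _⟩

lemma laplaceTransform_gammaSeriesTerm (hα : 0 < α) (Θ : Matrix (Fin 3) (Fin 3) ℝ)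
    (ha : ∀ j i, |a j i| < 1) (k : ℕ) {s : ((j : Fin 3) × Fin (n j)) → ℂ}
    (hs : ∀ u, 0 < (s u).re) :
    laplaceTransform (fun x => gammaSeriesTerm α Θ a x k) s =
      (∏ j, blockTransform α (a j) fun i => s ⟨j, i⟩) * (((ascPochhammer ℝ k).eval α / k ! : ℝ) *
        corrPoly (fun j => (oppositeCorr Θ j : ℂ))
          (fun j => blockRatio (a j) fun i => s ⟨j, i⟩) ^ k) := by
  simp only [gammaSeriesTerm_eq_sum_mul_prod_laguerreCoeff]
  choose C hC using exists_orthantExpBound_prod_laguerreCoeff hα ha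
  rw [laplaceTransform_sum (fun κ _ => (hC _).const_mul _) hs, Complex.ofReal_div,
    div_mul_eq_mul_div, mul_div_assoc, Complex.ofReal_natCast,
    ← sum_antidiagonalTuple_eq_corrPoly_pow, Finset.mul_sum, Finset.mul_sum]
  refine Finset.sum_congr rfl fun κ _ => ?_
  rw [laplaceTransform_const_mul,
    laplaceTransform_sigma_prod fun j y => laguerreCoeff (k - κ j.castSucc) y α (a j)]
  simp only [laplaceTransform_laguerreCoeff hα (ha _) _ fun _ => hs _, Finset.prod_mul_distrib]
  push_cast
  ring

end Term

/-! ### Growth bounds from the Laplace transform on a vertical line -/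

section Fourier

open FourierTransform

lemma norm_le_integral_of_norm_fourier_le {V : Type*} [NormedAddCommGroup V]
    [InnerProductSpace ℝ V] [FiniteDimensional ℝ V] [MeasurableSpace V] [BorelSpace V] {g : V → ℂ}
    (hcont : Continuous g) (hg : Integrable g) {B : V → ℝ} (hB : Integrable B)
    (hgB : ∀ w, ‖𝓕 g w‖ ≤ B w) (v : V) : ‖g v‖ ≤ ∫ w, B w := by
  have hF : Continuous (𝓕 g) := VectorFourier.fourierIntegral_continuous
    Real.continuous_fourierChar (by exact continuous_inner) hg
  rw [← congrFun (hcont.fourierInv_fourier_eq hg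
    (hB.mono' hF.aestronglyMeasurable (ae_of_all _ hgB))) v, Real.fourierInv_eq']
  refine norm_integral_le_of_norm_le hB (ae_of_all _ fun w => ?_)
  rw [norm_smul, Complex.norm_exp_ofReal_mul_I, one_mul]
  exact hgB w

variable {ι : Type*} [Fintype ι]

lemma fourier_exp_neg_mul_eq_laplaceTransform (f : (ι → ℝ) → ℝ) (σ : ℝ)
    (w : EuclideanSpace ℝ ι) :
    𝓕 (fun v : EuclideanSpace ℝ ι =>
      (∏ u, Complex.exp (-((σ : ℂ) * v u))) * (f (WithLp.ofLp v) : ℂ)) w =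
      laplaceTransform f fun u => σ + ((2 * Real.pi * w u : ℝ) : ℂ) * Complex.I := by
  rw [laplaceTransform, Real.fourier_eq',
    ← (EuclideanSpace.volume_preserving_symm_measurableEquiv_toLp ι).integral_comp' (g := fun x =>
      (∏ u, Complex.exp (-((σ + ((2 * Real.pi * w u : ℝ) : ℂ) * Complex.I) * x u))) * (f x : ℂ))]
  refine integral_congr_ae (ae_of_all _ fun v => ?_)
  simp only [smul_eq_mul, ← mul_assoc, MeasurableEquiv.coe_toLp_symm]
  congr 1
  rw [← Complex.exp_sum, ← Complex.exp_add, ← Complex.exp_sum]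
  congr 1
  simp only [PiLp.inner_apply, RCLike.inner_apply, conj_trivial]
  push_cast
  rw [Finset.mul_sum, Finset.sum_mul, ← Finset.sum_add_distrib]
  exact Finset.sum_congr rfl fun u _ => by ring

lemma OrthantExpBound.of_norm_laplaceTransform_le {f : (ι → ℝ) → ℝ} {C c σ : ℝ}
    (hf : OrthantExpBound f C c) (hcont : Continuous f) (hσ : c < σ) {B : (ι → ℝ) → ℝ}
    (hB : Integrable B)
    (hfB : ∀ w : ι → ℝ, ‖laplaceTransform f fun u =>
      σ + ((2 * Real.pi * w u : ℝ) : ℂ) * Complex.I‖ ≤ B w) :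
    OrthantExpBound f (∫ w, B w) σ where
  measurable := hf.measurable
  eq_zero := hf.eq_zero
  norm_le x := by
    have hmp := EuclideanSpace.volume_preserving_symm_measurableEquiv_toLp ι
    have hg : Integrable fun v : EuclideanSpace ℝ ι =>
        (∏ u, Complex.exp (-((σ : ℂ) * v u))) * (f (WithLp.ofLp v) : ℂ) :=
      hmp.integrable_comp_of_integrable
        (hf.integrable_kernel_mul (s := fun _ => (σ : ℂ)) fun _ => by simpa using hσ)
    have hgc : Continuous fun v : EuclideanSpace ℝ ι =>
        (∏ u, Complex.exp (-((σ : ℂ) * v u))) * (f (WithLp.ofLp v) : ℂ) := by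
      fun_prop
    have h := norm_le_integral_of_norm_fourier_le hgc hg (hmp.integrable_comp_of_integrable hB)
      (fun w => (fourier_exp_neg_mul_eq_laplaceTransform f σ w).symm ▸ hfB _) (WithLp.toLp 2 x)
    simp only [Function.comp_apply, hmp.integral_comp' (g := B)] at h
    simp only [norm_mul, norm_prod, norm_exp_neg_mul_ofReal, Complex.norm_real,
      ← Real.exp_sum, Finset.sum_neg_distrib, Complex.ofReal_re, ← Finset.mul_sum] at h
    rwa [Real.exp_neg, inv_mul_le_iff₀ (Real.exp_pos _), mul_comm] at h

end Fourier

lemma half_one_add_abs_le_norm_one_add_mul_I (t : ℝ) :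
    (1 + |t|) / 2 ≤ ‖1 + ((2 * Real.pi * t : ℝ) : ℂ) * Complex.I‖ := by
  have hre := Complex.abs_re_le_norm (1 + ((2 * Real.pi * t : ℝ) : ℂ) * Complex.I)
  have him := Complex.abs_im_le_norm (1 + ((2 * Real.pi * t : ℝ) : ℂ) * Complex.I)
  simp only [Complex.add_re, Complex.one_re, Complex.re_ofReal_mul, Complex.I_re, mul_zero,
    add_zero, abs_one] at hre
  simp only [Complex.add_im, Complex.one_im, Complex.im_ofReal_mul, Complex.I_im, mul_one,
    zero_add, abs_mul, abs_of_pos Real.two_pi_pos] at him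
  have : |t| ≤ 2 * Real.pi * |t| :=
    le_mul_of_one_le_left (abs_nonneg t) (by linarith [Real.pi_gt_three])
  linarith

lemma mul_norm_le_norm_one_add_smul {b : ℝ} (hb : 0 ≤ b) {s : ℂ} (hs : 0 ≤ s.re) :
    b * ‖s‖ ≤ ‖1 + b • s‖ := by
  rw [← Real.norm_of_nonneg hb, ← norm_smul, Real.norm_of_nonneg hb,
    ← sq_le_sq₀ (norm_nonneg _) (norm_nonneg _), Complex.sq_norm, Complex.sq_norm,
    Complex.normSq_apply, Complex.normSq_apply]
  simp only [Complex.add_re, Complex.one_re, Complex.add_im, Complex.one_im, zero_add,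
    Complex.smul_re, smul_eq_mul]
  linarith [mul_nonneg hb hs]

lemma norm_inv_mul_one_add_smul_cpow_le {α b : ℝ} (hα : 0 ≤ α) (hb : 0 < b) (t : ℝ) :
    ‖(1 + ((2 * Real.pi * t : ℝ) : ℂ) * Complex.I)⁻¹ *
      (1 + b • (1 + ((2 * Real.pi * t : ℝ) : ℂ) * Complex.I)) ^ (-(α : ℂ))‖ ≤
      2 * (b / 2) ^ (-α) * (1 + ‖t‖) ^ (-(1 + α)) := by
  have hnorm := half_one_add_abs_le_norm_one_add_mul_I t
  have hmul := mul_norm_le_norm_one_add_smul hb.le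
    (s := 1 + ((2 * Real.pi * t : ℝ) : ℂ) * Complex.I) (by simp)
  set s : ℂ := 1 + ((2 * Real.pi * t : ℝ) : ℂ) * Complex.I
  have ht : 0 < 1 + |t| := by positivity
  rw [norm_mul, norm_inv, ← Complex.ofReal_neg, Complex.norm_cpow_real]
  have hinv : ‖s‖⁻¹ ≤ 2 * (1 + |t|)⁻¹ := by
    rw [← div_eq_mul_inv, ← inv_div]
    exact inv_anti₀ (by positivity) hnorm
  have hpow : ‖1 + b • s‖ ^ (-α) ≤ (b / 2) ^ (-α) * (1 + |t|) ^ (-α) := by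
    rw [← Real.mul_rpow (by positivity) ht.le]
    refine Real.rpow_le_rpow_of_nonpos (by positivity) (le_trans ?_ hmul) (by linarith)
    rw [div_mul_eq_mul_div, ← mul_div_assoc']
    exact mul_le_mul_of_nonneg_left hnorm hb.le
  refine (mul_le_mul hinv hpow (by positivity) (by positivity)).trans_eq ?_
  rw [Real.norm_eq_abs, neg_add, Real.rpow_add ht, Real.rpow_neg_one]
  ring

lemma norm_one_add_cpow_neg_le_one {α : ℝ} (hα : 0 ≤ α) {z : ℂ} (hz : 0 ≤ z.re) :
    ‖(1 + z) ^ (-(α : ℂ))‖ ≤ 1 := by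
  rw [← Complex.ofReal_neg, Complex.norm_cpow_real]
  refine Real.rpow_le_one_of_one_le_of_nonpos ?_ (neg_nonpos.2 hα)
  have := Complex.re_le_norm (1 + z)
  rw [Complex.add_re, Complex.one_re] at this
  linarith

lemma norm_blockTransform_le {α : ℝ} (hα : 0 ≤ α) {m : ℕ} {a : Fin m → ℝ} (ha : ∀ i, |a i| < 1)
    (w : Fin m → ℝ) :
    ‖blockTransform α a fun i => 1 + ((2 * Real.pi * w i : ℝ) : ℂ) * Complex.I‖ ≤
      ∏ i, 2 * ((1 - a i ^ 2) / 2) ^ (-α) * (1 + ‖w i‖) ^ (-(1 + α)) := by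
  rw [blockTransform, norm_mul, norm_prod]
  refine (mul_le_of_le_one_right (Finset.prod_nonneg fun _ _ => norm_nonneg _)
    (norm_one_add_cpow_neg_le_one hα (re_nonneg_of_mem_diameterDisc
      (blockShift_mem_diameterDisc ha fun i => by simp)))).trans ?_
  exact Finset.prod_le_prod (fun _ _ => norm_nonneg _) fun i _ =>
    norm_inv_mul_one_add_smul_cpow_le hα (one_sub_sq_pos (ha i)) (w i)

section Term

variable {n : Fin 3 → ℕ} {α : ℝ} {Θ : Matrix (Fin 3) (Fin 3) ℝ} {a : (j : Fin 3) → Fin (n j) → ℝ}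

lemma exists_orthantExpBound_gammaSeriesTerm_geometric (hα : 0 < α) (ha : ∀ j i, |a j i| < 1)
    {q : ℝ} (hq : ∀ u : Fin 3 → ℂ, (∀ j, u j ∈ diameterDisc (blockRadius (a j))) →
      ‖corrPoly (fun j => (oppositeCorr Θ j : ℂ)) u‖ ≤ q) :
    ∃ C, ∀ k, OrthantExpBound (fun x => gammaSeriesTerm α Θ a x k)
      (C * ((ascPochhammer ℝ k).eval α / k ! * q ^ k)) 1 := by
  let B (w : ((j : Fin 3) × Fin (n j)) → ℝ) : ℝ :=
    ∏ u : (j : Fin 3) × Fin (n j),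
      2 * ((1 - a u.1 u.2 ^ 2) / 2) ^ (-α) * (1 + ‖w u‖) ^ (-(1 + α))
  have hB : Integrable B := Integrable.fintype_prod
    (f := fun (u : (j : Fin 3) × Fin (n j)) (t : ℝ) =>
      2 * ((1 - a u.1 u.2 ^ 2) / 2) ^ (-α) * (1 + ‖t‖) ^ (-(1 + α)))
    fun u => (integrable_one_add_norm (by simpa using hα)).const_mul _
  refine ⟨∫ w, B w, fun k => ?_⟩
  obtain ⟨C, hC⟩ := exists_orthantExpBound_gammaSeriesTerm hα Θ ha k
  rw [← integral_mul_const]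
  refine hC.of_norm_laplaceTransform_le (continuous_gammaSeriesTerm hα Θ ha k) one_pos
    (hB.mul_const _) fun w => ?_
  have hcoeff : 0 ≤ (ascPochhammer ℝ k).eval α / k ! :=
    div_nonneg (ascPochhammer_pos k α hα).le (Nat.cast_nonneg _)
  rw [Complex.ofReal_one, laplaceTransform_gammaSeriesTerm hα Θ ha k (by simp), norm_mul, norm_mul,
    norm_prod, norm_pow, Complex.norm_real, Real.norm_of_nonneg hcoeff]
  have hprefactor : ∏ j, ‖blockTransform α (a j) fun i =>
      1 + ((2 * Real.pi * w ⟨j, i⟩ : ℝ) : ℂ) * Complex.I‖ ≤ B w := by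
    simp only [B, Fintype.prod_sigma]
    exact Finset.prod_le_prod (fun _ _ => norm_nonneg _) fun j _ =>
      norm_blockTransform_le hα.le (ha j) fun i => w ⟨j, i⟩
  refine mul_le_mul hprefactor (mul_le_mul_of_nonneg_left ?_ hcoeff) (by positivity)
    ((Finset.prod_nonneg fun _ _ => norm_nonneg _).trans hprefactor)
  exact pow_le_pow_left₀ (norm_nonneg _)
    (hq _ fun j => blockRatio_mem_diameterDisc (ha j) (by simp)) k

end Term

/-! ### The maximum over the polydisc -/

lemma norm_le_of_forall_sphere_norm_le {ι E : Type*} [Finite ι] [NormedAddCommGroup E]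
    [NormedSpace ℂ E] {f : (ι → ℂ) → E} (hf : Differentiable ℂ f) {c : ι → ℂ} {r : ι → ℝ} {q : ℝ}
    (hq : ∀ z, (∀ i, z i ∈ Metric.sphere (c i) (r i)) → ‖f z‖ ≤ q) {u : ι → ℂ}
    (hu : ∀ i, u i ∈ Metric.closedBall (c i) (r i)) : ‖f u‖ ≤ q := by
  classical
  have := Fintype.ofFinite ι
  suffices H : ∀ (S : Finset ι) (u : ι → ℂ), (∀ i, u i ∈ Metric.closedBall (c i) (r i)) →
      (∀ i ∉ S, u i ∈ Metric.sphere (c i) (r i)) → ‖f u‖ ≤ q from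
    H Finset.univ u hu fun i hi => absurd (Finset.mem_univ i) hi
  intro S
  induction S using Finset.induction_on with
  | empty => exact fun u _ hu => hq u fun i => hu i (Finset.notMem_empty i)
  | insert i S _ ih =>
    intro u hu hS
    have hdiff : Differentiable ℂ fun z => f (Function.update u i z) :=
      hf.comp fun z => (hasFDerivAt_update u z).differentiableAt
    rw [← Function.update_eq_self i u]
    refine Complex.norm_le_of_forall_mem_frontier_norm_le Metric.isBounded_closedBall
      hdiff.diffContOnCl (fun z hz => ?_) (subset_closure (hu i))
    have hz' := Metric.frontier_closedBall_subset_sphere hz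
    refine ih _ (fun j => ?_) fun j hj => ?_ <;> rcases eq_or_ne j i with rfl | hji
    · simpa using Metric.sphere_subset_closedBall hz'
    · simpa [hji] using hu j
    · simpa using hz'
    · simpa [hji] using hS j (by simp [hji, hj])

lemma circlePoint_eq_add_mul_exp {m : ℕ} (a : Fin m → ℝ) (γ : ℝ) :
    circlePoint a γ = ((blockRadius a / 2 : ℝ) : ℂ) +
      ((blockRadius a / 2 : ℝ) : ℂ) * Complex.exp ((2 * γ : ℝ) * Complex.I) := by
  have hcancel : Complex.exp (-γ * Complex.I) * Complex.exp (γ * Complex.I) = 1 := by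
    rw [← Complex.exp_add, neg_mul, neg_add_cancel, Complex.exp_zero]
  have hsq : Complex.exp ((2 * γ : ℝ) * Complex.I) = Complex.exp (γ * Complex.I) ^ 2 := by
    rw [← Complex.exp_nat_mul]
    push_cast
    ring_nf
  rw [circlePoint, Complex.ofReal_cos, Complex.cos, mul_comm Complex.I, hsq]
  push_cast
  linear_combination (blockRadius a / 2 : ℂ) * hcancel

lemma exists_circlePoint_eq {m : ℕ} (a : Fin m → ℝ) {z : ℂ}
    (hz : z ∈ Metric.sphere ((blockRadius a / 2 : ℝ) : ℂ) (blockRadius a / 2)) :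
    ∃ γ ∈ Icc (-(Real.pi / 2)) (Real.pi / 2), circlePoint a γ = z := by
  set w := z - ((blockRadius a / 2 : ℝ) : ℂ) with hw
  have harg := Complex.arg_mem_Ioc w
  refine ⟨w.arg / 2, ⟨by linarith [harg.1], by linarith [harg.2]⟩, ?_⟩
  have hpolar : ((blockRadius a / 2 : ℝ) : ℂ) * Complex.exp (w.arg * Complex.I) = w := by
    rw [← mem_sphere_iff_norm.1 hz]
    exact Complex.norm_mul_exp_arg_mul_I w
  rw [circlePoint_eq_add_mul_exp, mul_div_cancel₀ _ two_ne_zero, hpolar, hw, add_sub_cancel]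

lemma rhoSq_eq_norm_corrPoly_sq {n : Fin 3 → ℕ} (Θ : Matrix (Fin 3) (Fin 3) ℝ)
    (a : (j : Fin 3) → Fin (n j) → ℝ) (γ : Fin 3 → ℝ) :
    rhoSq Θ a γ =
      ‖corrPoly (fun j => (oppositeCorr Θ j : ℂ)) fun j => circlePoint (a j) (γ j)‖ ^ 2 :=
  rfl

lemma MaxRhoSqLtOne.exists_norm_corrPoly_le {n : Fin 3 → ℕ} {Θ : Matrix (Fin 3) (Fin 3) ℝ}
    {a : (j : Fin 3) → Fin (n j) → ℝ} (h : MaxRhoSqLtOne Θ a) :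
    ∃ q : ℝ, 0 ≤ q ∧ q < 1 ∧ ∀ u : Fin 3 → ℂ, (∀ j, u j ∈ diameterDisc (blockRadius (a j))) →
      ‖corrPoly (fun j => (oppositeCorr Θ j : ℂ)) u‖ ≤ q := by
  obtain ⟨M, hM, hM1⟩ := h
  refine ⟨√M, Real.sqrt_nonneg _, by rwa [Real.sqrt_lt' one_pos, one_pow], fun u hu => ?_⟩
  refine norm_le_of_forall_sphere_norm_le ?_ (fun z hz => ?_) hu
  · unfold corrPoly
    fun_prop
  · choose γ hγ hγz using fun j => exists_circlePoint_eq (a j) (hz j)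
    refine Real.le_sqrt_of_sq_le (hM.2 ⟨γ, hγ, ?_⟩)
    simp only [rhoSq_eq_norm_corrPoly_sq, hγz]

/-! ### The determinant of `1 + R_Θ T` -/

section Det

variable {p : ℕ} {n : Fin p → ℕ}

lemma blockShift_ofReal {m : ℕ} (a t : Fin m → ℝ) :
    blockShift a (fun i => (t i : ℂ)) = (blockShift a t : ℝ) := by
  simp [blockShift]

lemma corrPoly_ofReal (t u : Fin 3 → ℝ) :
    corrPoly (fun j => (t j : ℂ)) (fun j => (u j : ℂ)) = (corrPoly t u : ℝ) := by
  simp [corrPoly]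

/-- The loading matrix of the one-factor blocks: column `j` is the vector `a j` on block `j` and
zero on the other blocks. -/
def blockLoading (a : (j : Fin p) → Fin (n j) → ℝ) :
    Matrix ((j : Fin p) × Fin (n j)) (Fin p) ℝ :=
  Matrix.of fun u j => if u.1 = j then a u.1 u.2 else 0

lemma blockCorrelation_eq_add_blockLoading_mul (Θ : Matrix (Fin p) (Fin p) ℝ)
    (a : (j : Fin p) → Fin (n j) → ℝ) :
    blockCorrelation Θ a = Matrix.diagonal (fun u => 1 - a u.1 u.2 ^ 2) +
      blockLoading a * Θ * (blockLoading a).transpose := by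
  rw [blockCorrelation]
  congr 1
  ext u v
  simp [blockLoading, Matrix.mul_apply, mul_comm, mul_left_comm]

lemma blockLoading_transpose_mul_diagonal_mul (a : (j : Fin p) → Fin (n j) → ℝ)
    (t : ((j : Fin p) × Fin (n j)) → ℝ) :
    (blockLoading a).transpose * Matrix.diagonal t * blockLoading a =
      Matrix.diagonal fun j => ∑ i, a j i ^ 2 * t ⟨j, i⟩ := by
  ext i j
  rw [Matrix.mul_apply, Fintype.sum_sigma, Matrix.diagonal_apply, Finset.sum_eq_single i]
  · by_cases hij : i = j
    · simp [blockLoading, hij, sq, mul_right_comm]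
    · simp [blockLoading, hij]
  · intro k _ hk
    simp [blockLoading, hk]
  · simp

lemma det_one_add_blockCorrelation_mul_diagonal (Θ : Matrix (Fin p) (Fin p) ℝ)
    {a : (j : Fin p) → Fin (n j) → ℝ} {t : ((j : Fin p) × Fin (n j)) → ℝ}
    (h : ∀ u, 1 + (1 - a u.1 u.2 ^ 2) * t u ≠ 0) :
    (1 + blockCorrelation Θ a * Matrix.diagonal t).det =
      (∏ u, (1 + (1 - a u.1 u.2 ^ 2) * t u)) *
        (1 + Θ * Matrix.diagonal fun j => blockShift (a j) fun i => t ⟨j, i⟩).det := by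
  set e : ((j : Fin p) × Fin (n j)) → ℝ := fun u => 1 + (1 - a u.1 u.2 ^ 2) * t u
  have hsplit : Matrix.diagonal t = Matrix.diagonal (fun u => t u / e u) * Matrix.diagonal e := by
    rw [Matrix.diagonal_mul_diagonal]
    exact congrArg _ (funext fun u => (div_mul_cancel₀ _ (h u)).symm)
  have hfactor : 1 + blockCorrelation Θ a * Matrix.diagonal t =
      (1 + blockLoading a * (Θ * (blockLoading a).transpose *
        Matrix.diagonal fun u => t u / e u)) * Matrix.diagonal e := by
    have hdiag : 1 + Matrix.diagonal (fun u : (j : Fin p) × Fin (n j) => 1 - a u.1 u.2 ^ 2) *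
        Matrix.diagonal t = Matrix.diagonal e := by
      rw [Matrix.diagonal_mul_diagonal, ← Matrix.diagonal_one, Matrix.diagonal_add]
    rw [blockCorrelation_eq_add_blockLoading_mul, add_mul, ← add_assoc, hdiag, add_mul, one_mul,
      hsplit]
    simp only [Matrix.mul_assoc]
  rw [hfactor, Matrix.det_mul, Matrix.det_diagonal, mul_comm, Matrix.det_one_add_mul_comm,
    Matrix.mul_assoc, Matrix.mul_assoc, ← Matrix.mul_assoc _ _ (blockLoading a),
    blockLoading_transpose_mul_diagonal_mul]
  rfl

lemma det_one_add_mul_diagonal_eq_corrPoly {Θ : Matrix (Fin 3) (Fin 3) ℝ} (hsymm : Θ.IsSymm)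
    (hdiag : ∀ i, Θ i i = 1) {z : Fin 3 → ℝ} (hz : ∀ j, 1 + z j ≠ 0) :
    (1 + Θ * Matrix.diagonal z).det =
      (∏ j, (1 + z j)) * (1 - corrPoly (oppositeCorr Θ) fun j => z j / (1 + z j)) := by
  have hz0 := hz 0
  have hz1 := hz 1
  have hz2 := hz 2
  rw [Matrix.det_fin_three, Fin.prod_univ_three, corrPoly, Fin.sum_univ_three, Fin.prod_univ_three]
  simp only [Fin.isValue, Matrix.add_apply, Matrix.one_apply_eq, Matrix.mul_diagonal, hdiag,
    one_mul, ne_eq, Fin.reduceEq, not_false_eq_true, Matrix.one_apply_ne, zero_add, zero_ne_one,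
    one_ne_zero, hsymm.apply 0 1, hsymm.apply 1 2, hsymm.apply 0 2, oppositeCorr, Fin.reduceAdd]
  field_simp
  ring

end Det

/-! ### The binomial series -/

lemma hasSum_ascPochhammer_mul_pow (α : ℝ) {x : ℝ} (hx : |x| < 1) :
    HasSum (fun k : ℕ => (ascPochhammer ℝ k).eval α / k ! * x ^ k) ((1 - x) ^ (-α)) := by
  have h := (Real.one_div_one_sub_rpow_hasFPowerSeriesOnBall_zero α).hasSum (y := x) (by
    simpa [enorm_eq_nnnorm, ← NNReal.coe_lt_coe] using hx)
  simp only [zero_add, one_div, ← Real.rpow_neg (sub_nonneg.2 (abs_lt.1 hx).2.le),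
    FormalMultilinearSeries.ofScalars_apply_eq, ring_choose_add_eq_ascPochhammer, smul_eq_mul] at h
  exact h

/-! ### Uniqueness of Laplace transforms on the orthant -/

section Uniqueness

open scoped NNReal BoundedContinuousFunction

variable {ι : Type*}

/-- The bounded function `e^{-y_u}` on the orthant; these functions generate an algebra that
separates points, to which the Stone–Weierstrass theorem applies. -/
noncomputable def expNegCoord (u : ι) : (ι → ℝ≥0) →ᵇ ℝ :=
  BoundedContinuousFunction.ofNormedAddCommGroup (fun y => Real.exp (-(y u : ℝ))) (by fun_prop) 1
    fun y => by simp

/-- The algebra of exponential polynomials on the orthant, generated by the functions `e^{-y_u}`. -/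
noncomputable def expNegAlgebra (ι : Type*) : StarSubalgebra ℝ ((ι → ℝ≥0) →ᵇ ℝ) where
  toSubalgebra := (MvPolynomial.aeval (R := ℝ) (expNegCoord (ι := ι))).range
  star_mem' {g} hg := by rwa [show star g = g from rfl]

lemma expNegAlgebra_separatesPoints : ((expNegAlgebra ι).map
    (BoundedContinuousFunction.toContinuousMapStarₐ ℝ)).SeparatesPoints := by
  intro x y hxy
  obtain ⟨u, hu⟩ := Function.ne_iff.1 hxy
  refine ⟨_, ⟨_, ⟨expNegCoord u, ⟨MvPolynomial.X u, by simp⟩, rfl⟩, rfl⟩, fun h => hu ?_⟩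
  exact NNReal.coe_injective (neg_injective (Real.exp_injective h))

variable [Fintype ι]

lemma prod_expNegCoord_pow_apply (m : ι → ℕ) (y : ι → ℝ≥0) :
    (∏ u, expNegCoord u ^ m u) y = ∏ u, Real.exp (-(m u * y u)) := by
  simp [expNegCoord, BoundedContinuousFunction.coe_prod, ← Real.exp_nat_mul]

lemma measure_nnreal_ext_of_integral_exp_neg_natCast_mul_eq {P P' : Measure (ι → ℝ≥0)}
    [IsFiniteMeasure P] [IsFiniteMeasure P']
    (h : ∀ m : ι → ℕ, ∫ y, ∏ u, Real.exp (-(m u * y u)) ∂P =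
      ∫ y, ∏ u, Real.exp (-(m u * y u)) ∂P') : P = P' := by
  refine ext_of_forall_mem_subalgebra_integral_eq_of_polish (𝕜 := ℝ)
    expNegAlgebra_separatesPoints ?_
  rintro _ ⟨q, rfl⟩
  change ∫ y, MvPolynomial.aeval expNegCoord q y ∂P = ∫ y, MvPolynomial.aeval expNegCoord q y ∂P'
  induction q using MvPolynomial.induction_on' with
  | monomial m r =>
    have hmonomial : ∀ y, MvPolynomial.aeval expNegCoord (MvPolynomial.monomial m r) y =
        r * ∏ u, Real.exp (-(m u * y u)) := fun y => by
      rw [MvPolynomial.aeval_monomial, Finsupp.prod_fintype _ _ fun _ => pow_zero _,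
        ← prod_expNegCoord_pow_apply]
      rfl
    simp only [hmonomial, integral_const_mul, h]
  | add p q hp hq =>
    simp only [map_add, BoundedContinuousFunction.add_apply]
    rw [integral_add (BoundedContinuousFunction.integrable P _)
      (BoundedContinuousFunction.integrable P _), hp, hq, integral_add
      (BoundedContinuousFunction.integrable P' _) (BoundedContinuousFunction.integrable P' _)]

lemma measure_ext_of_integral_exp_neg_natCast_mul_eq {P P' : Measure (ι → ℝ)}
    [IsFiniteMeasure P] [IsFiniteMeasure P'] (hP : ∀ᵐ x ∂P, ∀ u, 0 ≤ x u)
    (hP' : ∀ᵐ x ∂P', ∀ u, 0 ≤ x u)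
    (h : ∀ m : ι → ℕ, ∫ x, ∏ u, Real.exp (-(m u * x u)) ∂P =
      ∫ x, ∏ u, Real.exp (-(m u * x u)) ∂P') : P = P' := by
  let r : (ι → ℝ) → ι → ℝ≥0 := fun x u => (x u).toNNReal
  have hr : Measurable r := by fun_prop
  have hrecover : ∀ {Q : Measure (ι → ℝ)}, (∀ᵐ x ∂Q, ∀ u, 0 ≤ x u) →
      (Q.map r).map (fun y u => (y u : ℝ)) = Q := fun {Q} hQ => by
    rw [Measure.map_map (by fun_prop) hr]
    refine (Measure.map_congr ?_).trans Measure.map_id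
    filter_upwards [hQ] with x hx
    exact funext fun u => Real.coe_toNNReal _ (hx u)
  have hintegral : ∀ {Q : Measure (ι → ℝ)}, (∀ᵐ x ∂Q, ∀ u, 0 ≤ x u) → ∀ m : ι → ℕ,
      ∫ y, ∏ u, Real.exp (-(m u * y u)) ∂(Q.map r) =
        ∫ x, ∏ u, Real.exp (-(m u * x u)) ∂Q := fun {Q} hQ m => by
    rw [integral_map hr.aemeasurable (Measurable.aestronglyMeasurable (by fun_prop))]
    refine integral_congr_ae ?_
    filter_upwards [hQ] with x hx
    simp only [r, Real.coe_toNNReal _ (hx _)]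
  rw [← hrecover hP, ← hrecover hP', measure_nnreal_ext_of_integral_exp_neg_natCast_mul_eq
    fun m => (hintegral hP m).trans ((h m).trans (hintegral hP' m).symm)]

lemma ae_eq_of_integral_exp_neg_natCast_mul_eq {f g : (ι → ℝ) → ℝ} (hf : Integrable f)
    (hg : Integrable g) (hf0 : ∀ x, 0 ≤ f x) (hg0 : ∀ x, 0 ≤ g x)
    (hfs : ∀ x u, x u < 0 → f x = 0) (hgs : ∀ x u, x u < 0 → g x = 0)
    (h : ∀ m : ι → ℕ, ∫ x, (∏ u, Real.exp (-(m u * x u))) * f x =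
      ∫ x, (∏ u, Real.exp (-(m u * x u))) * g x) : f =ᵐ[volume] g := by
  have hnonneg : ∀ {f : (ι → ℝ) → ℝ}, Integrable f → (∀ x u, x u < 0 → f x = 0) →
      ∀ᵐ x ∂(volume.withDensity fun x => ENNReal.ofReal (f x)), ∀ u, 0 ≤ x u :=
    fun {f} hf hfs => by
      rw [ae_withDensity_iff' hf.1.aemeasurable.ennreal_ofReal]
      refine ae_of_all _ fun x hx u => not_lt.1 fun hu => hx ?_
      rw [hfs x u hu, ENNReal.ofReal_zero]
  have hintegral : ∀ {f : (ι → ℝ) → ℝ}, Integrable f → (∀ x, 0 ≤ f x) → ∀ m : ι → ℕ,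
      ∫ x, ∏ u, Real.exp (-(m u * x u)) ∂(volume.withDensity fun x => ENNReal.ofReal (f x)) =
        ∫ x, (∏ u, Real.exp (-(m u * x u))) * f x := fun {f} hf hf0 m => by
    rw [integral_withDensity_eq_integral_toReal_smul₀ hf.1.aemeasurable.ennreal_ofReal
      (ae_of_all _ fun x => ENNReal.ofReal_lt_top)]
    simp only [ENNReal.toReal_ofReal (hf0 _), smul_eq_mul, mul_comm]
  have := isFiniteMeasure_withDensity_ofReal hf.2
  have := isFiniteMeasure_withDensity_ofReal hg.2
  have hν := measure_ext_of_integral_exp_neg_natCast_mul_eq (hnonneg hf hfs) (hnonneg hg hgs)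
    fun m => (hintegral hf hf0 m).trans ((h m).trans (hintegral hg hg0 m).symm)
  have hae := (withDensity_eq_iff hf.1.aemeasurable.ennreal_ofReal
    hg.1.aemeasurable.ennreal_ofReal hf.lintegral_lt_top.ne).1 hν
  filter_upwards [hae] with x hx
  exact (ENNReal.ofReal_eq_ofReal_iff (hf0 x) (hg0 x)).1 hx

lemma ae_eq_zero_of_integral_exp_neg_natCast_mul_eq_zero {f : (ι → ℝ) → ℝ}
    (hfm : ∀ m : ι → ℕ, Integrable fun x => (∏ u, Real.exp (-(m u * x u))) * f x)
    (hfs : ∀ x u, x u < 0 → f x = 0)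
    (h : ∀ m : ι → ℕ, ∫ x, (∏ u, Real.exp (-(m u * x u))) * f x = 0) : f =ᵐ[volume] 0 := by
  have hf : Integrable f := by simpa using hfm 0
  have hprod : ∀ (m : ι → ℕ) (x : ι → ℝ), 0 ≤ ∏ u, Real.exp (-(m u * x u)) := fun m x =>
    Finset.prod_nonneg fun _ _ => (Real.exp_pos _).le
  have hae : (fun x => max (f x) 0) =ᵐ[volume] fun x => max (-f x) 0 := by
    refine ae_eq_of_integral_exp_neg_natCast_mul_eq hf.pos_part hf.neg_part
      (fun x => le_max_right _ _) (fun x => le_max_right _ _)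
      (fun x u hu => by simp [hfs x u hu]) (fun x u hu => by simp [hfs x u hu]) fun m => ?_
    simp only [mul_max_of_nonneg _ _ (hprod m _), mul_zero, mul_neg]
    rw [← sub_eq_zero, ← integral_sub (hfm m).pos_part (hfm m).neg_part]
    simpa only [max_zero_sub_max_neg_zero_eq_self] using h m
  filter_upwards [hae] with x hx
  rw [← max_zero_sub_max_neg_zero_eq_self (f x), hx, sub_self, Pi.zero_apply]

lemma laplaceTransform_ofReal (f : (ι → ℝ) → ℝ) (t : ι → ℝ) :
    laplaceTransform f (fun u => (t u : ℂ)) =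
      ((∫ x, (∏ u, Real.exp (-(t u * x u))) * f x : ℝ) : ℂ) := by
  rw [laplaceTransform, ← integral_complex_ofReal]
  push_cast
  rfl

lemma OrthantExpBound.integrable_exp_neg_mul {f : (ι → ℝ) → ℝ} {C c : ℝ}
    (hf : OrthantExpBound f C c) {t : ι → ℝ} (ht : ∀ u, c < t u) :
    Integrable fun x => (∏ u, Real.exp (-(t u * x u))) * f x := by
  have h := (hf.integrable_kernel_mul (s := fun u => (t u : ℂ)) ht).re
  simpa only [← Complex.ofReal_mul, ← Complex.ofReal_neg, ← Complex.ofReal_exp,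
    ← Complex.ofReal_prod, RCLike.re_to_complex, Complex.ofReal_re] using h

lemma OrthantExpBound.ae_eq_of_laplaceTransform_eq {f g : (ι → ℝ) → ℝ} {C C' c : ℝ}
    (hf : OrthantExpBound f C c) (hg : OrthantExpBound g C' c)
    (h : ∀ t : ι → ℝ, (∀ u, c < t u) →
      laplaceTransform f (fun u => (t u : ℂ)) = laplaceTransform g fun u => (t u : ℂ)) :
    f =ᵐ[volume] g := by
  have hshift : ∀ (m : ι → ℕ) (x : ι → ℝ), (∏ u, Real.exp (-(m u * x u))) *
      ((∏ u, Real.exp (-((c + 1) * x u))) * (f x - g x)) =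
      (∏ u, Real.exp (-((c + 1 + m u) * x u))) * f x -
        (∏ u, Real.exp (-((c + 1 + m u) * x u))) * g x := fun m x => by
    rw [← mul_assoc, ← Finset.prod_mul_distrib, ← mul_sub]
    simp only [← Real.exp_add, add_mul _ (_ : ℝ) (x _), neg_add_rev]
  have hlt : ∀ (m : ι → ℕ) u, c < c + 1 + m u := fun m u => by
    linarith [(m u).cast_nonneg (α := ℝ)]
  have hzero := ae_eq_zero_of_integral_exp_neg_natCast_mul_eq_zero
    (f := fun x => (∏ u, Real.exp (-((c + 1) * x u))) * (f x - g x))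
    (fun m => by
      simp only [hshift]
      exact (hf.integrable_exp_neg_mul (hlt m)).sub (hg.integrable_exp_neg_mul (hlt m)))
    (fun x u hu => by simp only [hf.eq_zero x u hu, hg.eq_zero x u hu, sub_self, mul_zero])
    fun m => by
      simp only [hshift]
      rw [integral_sub (hf.integrable_exp_neg_mul (hlt m)) (hg.integrable_exp_neg_mul (hlt m)),
        sub_eq_zero]
      have hm := h _ (hlt m)
      rw [laplaceTransform_ofReal, laplaceTransform_ofReal] at hm
      exact Complex.ofReal_injective hm
  filter_upwards [hzero] with x hx
  exact sub_eq_zero.1 ((mul_eq_zero.1 hx).resolve_left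
    (Finset.prod_ne_zero_iff.2 fun _ _ => (Real.exp_pos _).ne'))

end Uniqueness

/-! ### Distribution functions on the orthant -/

lemma continuousWithinAt_measureReal_Iic {X : Type*} [Preorder X] [TopologicalSpace X]
    [OrderClosedTopology X] [FirstCountableTopology X] [MeasurableSpace X] [OpensMeasurableSpace X]
    (μ : Measure X) [IsFiniteMeasure μ] (x : X) :
    ContinuousWithinAt (fun y => μ.real (Iic y)) (Ici x) x := by
  refine (ENNReal.tendsto_toReal (measure_ne_top μ _)).comp
    (tendsto_measure_of_tendsto_indicator_of_isFiniteMeasure _ μ (fun y => measurableSet_Iic) ?_)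
  refine fun z => ?_
  by_cases hz : z ≤ x
  · filter_upwards [self_mem_nhdsWithin] with y hy
    exact iff_of_true (hz.trans hy) hz
  · filter_upwards [mem_nhdsWithin_of_mem_nhds (isClosed_Ici.isOpen_compl.mem_nhds hz)] with y hy
    exact iff_of_false hy hz

section Cdf

variable {ι : Type*} [Fintype ι]

lemma eq_of_ae_eq_of_continuousWithinAt_Ici {E : Type*} [TopologicalSpace E] [T2Space E]
    {f g : (ι → ℝ) → E} (hf : ∀ x, ContinuousWithinAt f (Ici x) x)
    (hg : ∀ x, ContinuousWithinAt g (Ici x) x) (h : f =ᵐ[volume] g) : f = g := by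
  funext x
  let U : Set (ι → ℝ) := univ.pi fun u => Ioi (x u)
  have hxU : x ∈ closure U := by simp [U, closure_pi_set]
  have hUopen : IsOpen U := isOpen_set_pi finite_univ fun _ _ => isOpen_Ioi
  have hx : x ∈ closure (U ∩ {y | f y = g y}) := closure_minimal
    ((Measure.dense_of_ae h).open_subset_closure_inter hUopen) isClosed_closure hxU
  have := mem_closure_iff_nhdsWithin_neBot.1 hx
  have hle : 𝓝[U ∩ {y | f y = g y}] x ≤ 𝓝[≥] x :=
    nhdsWithin_mono _ fun y hy u => (hy.1 u (mem_univ u)).le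
  refine tendsto_nhds_unique_of_eventuallyEq ((hf x).mono_left hle) ((hg x).mono_left hle) ?_
  filter_upwards [self_mem_nhdsWithin] with y hy using hy.2

lemma integrableOn_prod_exp_neg_mul_Ici {s : ι → ℂ} (hs : ∀ u, 0 < (s u).re) (y : ι → ℝ) :
    IntegrableOn (fun x : ι → ℝ => ∏ u, Complex.exp (-(s u * x u))) (Ici y) := by
  rw [IntegrableOn, ← pi_univ_Ici, volume_pi, Measure.restrict_pi_pi]
  exact Integrable.fintype_prod (f := fun u (x : ℝ) => Complex.exp (-(s u * x)))
    fun u => integrableOn_exp_neg_mul_Ici (hs u) (y u)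

lemma integral_prod_exp_neg_mul_Ici {s : ι → ℂ} (hs : ∀ u, 0 < (s u).re) (y : ι → ℝ) :
    ∫ x in Ici y, ∏ u, Complex.exp (-(s u * x u)) =
      (∏ u, (s u)⁻¹) * ∏ u, Complex.exp (-(s u * y u)) := by
  rw [← pi_univ_Ici, volume_pi, Measure.restrict_pi_pi,
    integral_fintype_prod_eq_prod (fun u (x : ℝ) => Complex.exp (-(s u * x)))]
  simp only [integral_exp_neg_mul_Ici (hs _), Finset.prod_mul_distrib]

variable {μ : Measure (ι → ℝ)}

lemma orthantExpBound_measureReal_Iic [IsProbabilityMeasure μ] (hμ : ∀ᵐ x ∂μ, ∀ u, 0 ≤ x u) :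
    OrthantExpBound (fun x => μ.real (Iic x)) 1 0 where
  measurable :=
    (measurable_measure_prodMk_left (measurableSet_le measurable_snd measurable_fst)).ennreal_toReal
  eq_zero x u hx := by
    refine (measureReal_eq_zero_iff).2 (measure_eq_zero_iff_ae_notMem.2 ?_)
    filter_upwards [hμ] with y hy hyx
    exact ((hyx u).trans_lt hx).not_ge (hy u)
  norm_le x := by
    rw [zero_mul, Real.exp_zero, one_mul, Real.norm_of_nonneg measureReal_nonneg]
    exact measureReal_le_one

lemma laplaceTransform_measureReal_Iic [IsFiniteMeasure μ] (hμ : ∀ᵐ x ∂μ, ∀ u, 0 ≤ x u)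
    {s : ι → ℂ} (hs : ∀ u, 0 < (s u).re) :
    laplaceTransform (fun x => μ.real (Iic x)) s =
      (∏ u, (s u)⁻¹) * ∫ x, ∏ u, Complex.exp (-(s u * x u)) ∂μ := by
  rw [laplaceTransform, integral_mul_measureReal_Iic hμ (integrableOn_prod_exp_neg_mul_Ici hs 0)]
  simp only [integral_prod_exp_neg_mul_Ici hs, integral_const_mul]

lemma laplaceTransform_measureReal_Iic_ofReal [IsFiniteMeasure μ] (hμ : ∀ᵐ x ∂μ, ∀ u, 0 ≤ x u)
    {t : ι → ℝ} (ht : ∀ u, 0 < t u) :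
    laplaceTransform (fun x => μ.real (Iic x)) (fun u => (t u : ℂ)) =
      (((∏ u, (t u)⁻¹) * ∫ x, Real.exp (-∑ u, t u * x u) ∂μ : ℝ) : ℂ) := by
  rw [laplaceTransform_measureReal_Iic hμ (by simpa using ht), Complex.ofReal_mul,
    ← integral_complex_ofReal]
  simp only [← Complex.exp_sum, Finset.sum_neg_distrib]
  push_cast
  rfl

end Cdf

/-! ### The series for the distribution function -/

lemma blockShift_nonneg {m : ℕ} {a : Fin m → ℝ} (ha : ∀ i, |a i| < 1) {t : Fin m → ℝ}
    (ht : ∀ i, 0 ≤ t i) : 0 ≤ blockShift a t :=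
  Finset.sum_nonneg fun i _ => mul_nonneg (sq_nonneg _)
    (div_nonneg (ht i) (add_nonneg zero_le_one (mul_nonneg (one_sub_sq_pos (ha i)).le (ht i))))

lemma blockRatio_ofReal {m : ℕ} (a t : Fin m → ℝ) :
    blockRatio a (fun i => (t i : ℂ)) = (blockRatio a t : ℝ) := by
  simp only [blockRatio, blockShift_ofReal]
  push_cast
  rfl

lemma blockTransform_ofReal (α : ℝ) {m : ℕ} {a : Fin m → ℝ} (ha : ∀ i, |a i| < 1) {t : Fin m → ℝ}
    (ht : ∀ i, 0 ≤ t i) :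
    blockTransform α a (fun i => (t i : ℂ)) =
      (((∏ i, (t i)⁻¹ * (1 + (1 - a i ^ 2) * t i) ^ (-α)) *
        (1 + blockShift a t) ^ (-α) : ℝ) : ℂ) := by
  have hfactor : ∀ i, 0 ≤ 1 + (1 - a i ^ 2) * t i := fun i =>
    add_nonneg zero_le_one (mul_nonneg (one_sub_sq_pos (ha i)).le (ht i))
  have hshift : 0 ≤ 1 + blockShift a t := by
    have := blockShift_nonneg ha ht
    positivity
  simp only [blockTransform, blockShift_ofReal, Complex.ofReal_mul, Complex.ofReal_prod,
    Complex.ofReal_cpow hshift, Complex.ofReal_cpow (hfactor _), Complex.real_smul]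
  push_cast
  rfl

section Term

variable {n : Fin 3 → ℕ} {α : ℝ} {Θ : Matrix (Fin 3) (Fin 3) ℝ} {a : (j : Fin 3) → Fin (n j) → ℝ}
  {t : ((j : Fin 3) × Fin (n j)) → ℝ}

lemma abs_corrPoly_blockRatio_le (ha : ∀ j i, |a j i| < 1) {q : ℝ}
    (hq : ∀ u : Fin 3 → ℂ, (∀ j, u j ∈ diameterDisc (blockRadius (a j))) →
      ‖corrPoly (fun j => (oppositeCorr Θ j : ℂ)) u‖ ≤ q) (ht : ∀ u, 0 ≤ t u) :
    |corrPoly (oppositeCorr Θ) fun j => blockRatio (a j) fun i => t ⟨j, i⟩| ≤ q := by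
  rw [← Real.norm_eq_abs, ← Complex.norm_real, ← corrPoly_ofReal]
  refine hq _ fun j => ?_
  rw [← blockRatio_ofReal]
  exact blockRatio_mem_diameterDisc (ha j) fun i => ht _

lemma laplaceTransform_gammaSeriesTerm_ofReal (hα : 0 < α) (Θ : Matrix (Fin 3) (Fin 3) ℝ)
    (ha : ∀ j i, |a j i| < 1) (k : ℕ) (ht : ∀ u, 0 < t u) :
    laplaceTransform (fun x => gammaSeriesTerm α Θ a x k) (fun u => (t u : ℂ)) =
      (∏ j, blockTransform α (a j) fun i => (t ⟨j, i⟩ : ℂ)) *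
        (((ascPochhammer ℝ k).eval α / k ! *
          (corrPoly (oppositeCorr Θ) fun j => blockRatio (a j) fun i => t ⟨j, i⟩) ^ k : ℝ) :
          ℂ) := by
  rw [laplaceTransform_gammaSeriesTerm hα Θ ha k (by simpa using ht)]
  simp only [blockRatio_ofReal, corrPoly_ofReal]
  push_cast
  rfl

lemma prod_inv_mul_det_rpow_eq (hsymm : Θ.IsSymm) (hdiag : ∀ i, Θ i i = 1)
    (ha : ∀ j i, |a j i| < 1) (ht : ∀ u, 0 ≤ t u)
    (hcorr : (corrPoly (oppositeCorr Θ) fun j => blockRatio (a j) fun i => t ⟨j, i⟩) ≤ 1) :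
    (((∏ u, (t u)⁻¹) * (1 + blockCorrelation Θ a * Matrix.diagonal t).det ^ (-α) : ℝ) : ℂ) =
      (∏ j, blockTransform α (a j) fun i => (t ⟨j, i⟩ : ℂ)) *
        (((1 - corrPoly (oppositeCorr Θ) fun j => blockRatio (a j) fun i => t ⟨j, i⟩) ^ (-α) : ℝ) :
          ℂ) := by
  have hfactor : ∀ u, 0 < 1 + (1 - a u.1 u.2 ^ 2) * t u := fun u =>
    add_pos_of_pos_of_nonneg one_pos (mul_nonneg (one_sub_sq_pos (ha u.1 u.2)).le (ht u))
  have hshift : ∀ j, 0 < 1 + blockShift (a j) fun i => t ⟨j, i⟩ := fun j =>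
    add_pos_of_pos_of_nonneg one_pos (blockShift_nonneg (ha j) fun i => ht _)
  have hprod := Finset.prod_nonneg fun j (_ : j ∈ Finset.univ) => (hshift j).le
  simp only [blockRatio] at hcorr ⊢
  simp only [blockTransform_ofReal α (ha _) fun i => ht ⟨_, i⟩, ← Complex.ofReal_prod,
    ← Complex.ofReal_mul]
  rw [det_one_add_blockCorrelation_mul_diagonal Θ fun u => (hfactor u).ne',
    det_one_add_mul_diagonal_eq_corrPoly hsymm hdiag fun j => (hshift j).ne',
    Real.mul_rpow (Finset.prod_nonneg fun u _ => (hfactor u).le)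
      (mul_nonneg hprod (sub_nonneg.2 hcorr)), Real.mul_rpow hprod (sub_nonneg.2 hcorr),
    ← Real.finsetProd_rpow _ _ fun u _ => (hfactor u).le,
    ← Real.finsetProd_rpow _ _ fun j _ => (hshift j).le, ← mul_assoc, ← mul_assoc,
    ← Finset.prod_mul_distrib, Fintype.prod_sigma, ← Finset.prod_mul_distrib]

theorem hasSum_gammaSeriesTerm (hα : 0 < α) (ha : ∀ j i, |a j i| < 1) (hsymm : Θ.IsSymm)
    (hdiag : ∀ i, Θ i i = 1) (hmax : MaxRhoSqLtOne Θ a)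
    {μ : Measure (((j : Fin 3) × Fin (n j)) → ℝ)}
    (hμ : IsMultivariateGamma α (blockCorrelation Θ a) μ) (x : ((j : Fin 3) × Fin (n j)) → ℝ) :
    HasSum (gammaSeriesTerm α Θ a x) (μ.real (Iic x)) := by
  have := hμ.isProbabilityMeasure
  obtain ⟨q, hq0, hq1, hq⟩ := hmax.exists_norm_corrPoly_le
  obtain ⟨C, hbound⟩ := exists_orthantExpBound_gammaSeriesTerm_geometric hα ha hq
  have hC : Summable fun k : ℕ => C * ((ascPochhammer ℝ k).eval α / k ! * q ^ k) :=
    (hasSum_ascPochhammer_mul_pow α (by rwa [abs_of_nonneg hq0])).summable.mul_left C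
  have hcont := OrthantExpBound.continuous_tsum hbound hC (continuous_gammaSeriesTerm hα Θ ha)
  have hcdf := (orthantExpBound_measureReal_Iic hμ.nonneg).mono zero_le_one
  have htransform : ∀ t : ((j : Fin 3) × Fin (n j)) → ℝ, (∀ u, 1 < t u) →
      laplaceTransform (fun x => μ.real (Iic x)) (fun u => (t u : ℂ)) =
        laplaceTransform (fun x => ∑' k, gammaSeriesTerm α Θ a x k) fun u => (t u : ℂ) := by
    intro t ht
    have ht0 : ∀ u, 0 < t u := fun u => one_pos.trans (ht u)
    have hcorr := (abs_corrPoly_blockRatio_le ha hq fun u => (ht0 u).le).trans_lt hq1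
    have hseries := hasSum_laplaceTransform_tsum hbound hC (s := fun u => (t u : ℂ)) ht
    simp only [laplaceTransform_gammaSeriesTerm_ofReal hα Θ ha _ ht0] at hseries
    rw [laplaceTransform_measureReal_Iic_ofReal hμ.nonneg ht0, hμ.laplace t fun u => (ht0 u).le,
      prod_inv_mul_det_rpow_eq hsymm hdiag ha (fun u => (ht0 u).le) (abs_lt.1 hcorr).2.le]
    exact ((Complex.hasSum_ofReal.2 (hasSum_ascPochhammer_mul_pow α hcorr)).mul_left _).unique
      hseries
  have heq := eq_of_ae_eq_of_continuousWithinAt_Ici (continuousWithinAt_measureReal_Iic μ)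
    (fun x => hcont.continuousWithinAt)
    (hcdf.ae_eq_of_laplaceTransform_eq (OrthantExpBound.tsum hbound hC) htransform)
  rw [congrFun heq x]
  exact (OrthantExpBound.summable hbound hC x).hasSum

end Term

/-! ### A sufficient condition for `max ρ² < 1` -/

lemma det_one_add_mul_diagonal_pos {ι : Type*} [Fintype ι] [DecidableEq ι]
    {R : Matrix ι ι ℝ} (hR : R.PosSemidef) {z : ι → ℝ} (hz : ∀ i, 0 ≤ z i) :
    0 < (1 + R * Matrix.diagonal z).det := by
  set S : Matrix ι ι ℝ := Matrix.diagonal fun i => √(z i)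
  have hS : Matrix.diagonal z = S * S := by
    simp only [S, Matrix.diagonal_mul_diagonal, Real.mul_self_sqrt (hz _)]
  have hconj : (S * R * S).PosSemidef := by
    simpa only [S, Matrix.diagonal_conjTranspose, star_trivial] using
      hR.mul_mul_conjTranspose_same S
  rw [hS, ← Matrix.mul_assoc, Matrix.det_one_add_mul_comm, ← Matrix.mul_assoc]
  exact (Matrix.PosDef.one.add_posSemidef hconj).det_pos

lemma sq_le_one_of_posSemidef {ι : Type*} {R : Matrix ι ι ℝ} (hR : R.PosSemidef)
    (hdiag : ∀ i, R i i = 1) (i j : ι) : R i j ^ 2 ≤ 1 := by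
  have hdet := (hR.submatrix ![i, j]).det_nonneg
  simp only [Matrix.det_fin_two, Matrix.submatrix_apply, Matrix.cons_val_zero,
    Matrix.cons_val_one, hdiag] at hdet
  have hsymm : R j i = R i j := by simpa using (hR.isHermitian.apply i j)
  rw [hsymm] at hdet
  linarith

lemma norm_corrPoly_cos_mul_exp_sq (p γ : Fin 3 → ℝ) :
    ‖corrPoly (fun j => (p j : ℂ))
        fun j => (Real.cos (γ j) : ℂ) * Complex.exp (Complex.I * (γ j : ℂ))‖ ^ 2 =
      (corrPoly p 1 * ∏ j, Real.cos (γ j)) ^ 2 +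
        (∑ j, p j ^ 2 * (Real.sin (γ j) * (Real.cos (γ (j + 1)) * Real.cos (γ (j + 2))))) ^ 2 := by
  -- Divide by the unimodular number `∏ e^{iγⱼ}`; only `e^{-iγⱼ}` is left in the `j`-th term.
  set A := corrPoly p 1 * ∏ j, Real.cos (γ j)
  set B := ∑ j, p j ^ 2 * (Real.sin (γ j) * (Real.cos (γ (j + 1)) * Real.cos (γ (j + 2))))
  have hexp : ∀ j, Complex.exp (Complex.I * γ j) * (Real.cos (γ j) - Real.sin (γ j) * Complex.I) =
      1 := fun j => by
    rw [mul_comm Complex.I, Complex.exp_mul_I, Complex.ofReal_cos, Complex.ofReal_sin]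
    linear_combination Complex.cos_sq_add_sin_sq (γ j) - Complex.sin (γ j) ^ 2 * Complex.I_sq
  have hfactor : corrPoly (fun j => (p j : ℂ))
      (fun j => (Real.cos (γ j) : ℂ) * Complex.exp (Complex.I * (γ j : ℂ))) =
      (∏ j, Complex.exp (Complex.I * γ j)) * (A + (-B : ℝ) * Complex.I) := by
    simp only [A, B, corrPoly, Fin.sum_univ_three, Fin.prod_univ_three, Pi.one_apply]
    have h0 := hexp 0
    have h1 := hexp 1
    have h2 := hexp 2
    push_cast at h0 h1 h2 ⊢
    generalize Complex.exp (Complex.I * γ 0) = e₀ at *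
    generalize Complex.exp (Complex.I * γ 1) = e₁ at *
    generalize Complex.exp (Complex.I * γ 2) = e₂ at *
    generalize Complex.cos (γ 0) = c₀ at *
    generalize Complex.cos (γ 1) = c₁ at *
    generalize Complex.cos (γ 2) = c₂ at *
    linear_combination -(p 0 ^ 2 * c₁ * c₂ * e₁ * e₂ : ℂ) * h0 -
      (p 1 ^ 2 * c₂ * c₀ * e₂ * e₀ : ℂ) * h1 - (p 2 ^ 2 * c₀ * c₁ * e₀ * e₁ : ℂ) * h2
  have hunit : ∀ j, ‖Complex.exp (Complex.I * γ j)‖ = 1 := fun j => by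
    rw [mul_comm, Complex.norm_exp_ofReal_mul_I]
  rw [hfactor, norm_mul, norm_prod, Finset.prod_congr rfl fun j _ => hunit j, Finset.prod_const_one,
    one_mul, Complex.sq_norm, Complex.normSq_add_mul_I, neg_sq]

lemma prod_cos_sq_add_sum_sq_le_one (γ : Fin 3 → ℝ) :
    (∏ j, Real.cos (γ j)) ^ 2 +
      ∑ j, (Real.sin (γ j) * (Real.cos (γ (j + 1)) * Real.cos (γ (j + 2)))) ^ 2 ≤ 1 := by
  have hone : ∏ j, (Real.cos (γ j) ^ 2 + Real.sin (γ j) ^ 2) = 1 :=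
    Finset.prod_eq_one fun j _ => Real.cos_sq_add_sin_sq (γ j)
  simp only [Fin.prod_univ_three, Fin.sum_univ_three, Fin.isValue, Fin.reduceAdd] at hone ⊢
  generalize Real.cos (γ 0) = c₀, Real.cos (γ 1) = c₁, Real.cos (γ 2) = c₂ at hone ⊢
  generalize Real.sin (γ 0) = s₀, Real.sin (γ 1) = s₁, Real.sin (γ 2) = s₂ at hone ⊢
  have hrest : 0 ≤ (c₀ * s₁ * s₂) ^ 2 + (c₁ * s₀ * s₂) ^ 2 + (c₂ * s₀ * s₁) ^ 2 +
    (s₀ * s₁ * s₂) ^ 2 := by positivity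
  linarith

lemma mul_prod_cos_sq_add_sum_sq_lt_one {p : Fin 3 → ℝ} {S : ℝ} (hp : ∀ j, p j ^ 2 < 1)
    (hsum : ∑ j, p j ^ 4 ≤ 1) (hS : |S| < 1) (γ : Fin 3 → ℝ) :
    (S * ∏ j, Real.cos (γ j)) ^ 2 +
      (∑ j, p j ^ 2 * (Real.sin (γ j) * (Real.cos (γ (j + 1)) * Real.cos (γ (j + 2))))) ^ 2 <
        1 := by
  have hle := prod_cos_sq_add_sum_sq_le_one γ
  set x : Fin 3 → ℝ := fun j =>
    Real.sin (γ j) * (Real.cos (γ (j + 1)) * Real.cos (γ (j + 2))) with hx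
  change _ + ∑ j, x j ^ 2 ≤ 1 at hle
  change _ + (∑ j, p j ^ 2 * x j) ^ 2 < 1
  have hx0 : 0 ≤ ∑ j, x j ^ 2 := Finset.sum_nonneg fun j _ => sq_nonneg _
  by_cases hcos : ∏ j, Real.cos (γ j) = 0
  · obtain ⟨i, -, hi⟩ := Finset.prod_eq_zero_iff.1 hcos
    have hzero : ∀ j, j ≠ i → x j = 0 := fun j hj => by
      have hshift : ∀ i j : Fin 3, j ≠ i → j + 1 = i ∨ j + 2 = i := by decide
      rcases hshift i j hj with rfl | rfl <;> simp [hx, hi]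
    have hxi : x i ^ 2 ≤ 1 := by
      rw [hcos, Fintype.sum_eq_single i fun j hj => by rw [hzero j hj, sq, zero_mul]] at hle
      linarith
    rw [hcos, mul_zero, sq, zero_mul, zero_add,
      Fintype.sum_eq_single i fun j hj => by rw [hzero j hj, mul_zero], mul_pow]
    exact mul_lt_one_of_nonneg_of_lt_one_left (by positivity)
      (pow_lt_one₀ (sq_nonneg _) (hp i) two_ne_zero) hxi
  · calc (S * ∏ j, Real.cos (γ j)) ^ 2 + (∑ j, p j ^ 2 * x j) ^ 2
        ≤ (S * ∏ j, Real.cos (γ j)) ^ 2 + (∑ j, (p j ^ 2) ^ 2) * ∑ j, x j ^ 2 := by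
          gcongr
          exact Finset.sum_mul_sq_le_sq_mul_sq _ _ _
      _ ≤ S ^ 2 * (∏ j, Real.cos (γ j)) ^ 2 + ∑ j, x j ^ 2 := by
          rw [mul_pow]
          simp only [← pow_mul]
          gcongr
          exact mul_le_of_le_one_left hx0 hsum
      _ < (∏ j, Real.cos (γ j)) ^ 2 + ∑ j, x j ^ 2 := by
          gcongr
          exact mul_lt_of_lt_one_left (by positivity) ((sq_lt_one_iff_abs_lt_one S).2 hS)
      _ ≤ 1 := hle

lemma corrPoly_mul_mul {K : Type*} [CommRing K] (t r u : Fin 3 → K) :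
    corrPoly (fun j => t j * (r (j + 1) * r (j + 2))) u = corrPoly t fun j => r j ^ 2 * u j := by
  simp only [corrPoly, Fin.sum_univ_three, Fin.prod_univ_three, Fin.isValue, Fin.reduceAdd]
  ring

lemma corrPoly_one_nonneg {t : Fin 3 → ℝ} (ht : ∀ j, t j ^ 2 ≤ 1) : 0 ≤ corrPoly t 1 := by
  have hsq : corrPoly t 1 =
      (t 0 - t 1 * t 2) ^ 2 + t 1 ^ 2 * (1 - t 2 ^ 2) + t 2 ^ 2 := by
    simp only [corrPoly, Fin.sum_univ_three, Fin.prod_univ_three, Pi.one_apply]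
    ring
  have := mul_nonneg (sq_nonneg (t 1)) (sub_nonneg.2 (ht 2))
  rw [hsq]
  positivity

lemma blockRadius_mem_Ico {m : ℕ} {a : Fin m → ℝ} (ha : ∀ i, |a i| < 1) :
    blockRadius a ∈ Ico (0 : ℝ) 1 := by
  have hsum := sum_sq_div_one_sub_sq_nonneg ha
  exact ⟨by unfold blockRadius; positivity, (div_lt_one (by positivity)).2 (lt_one_add _)⟩

section ScaledCorr

variable {n : Fin 3 → ℕ} {a : (j : Fin 3) → Fin (n j) → ℝ} {Θ : Matrix (Fin 3) (Fin 3) ℝ}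

lemma scaledCorr_eq_mul_sqrt_mul_sqrt (Θ : Matrix (Fin 3) (Fin 3) ℝ) (ha : ∀ j i, |a j i| < 1)
    (j : Fin 3) :
    scaledCorr Θ a j =
      oppositeCorr Θ j * (√(blockRadius (a (j + 1))) * √(blockRadius (a (j + 2)))) := by
  rw [scaledCorr, Real.sqrt_mul (blockRadius_mem_Ico (ha _)).1]

lemma corrPoly_scaledCorr_one (Θ : Matrix (Fin 3) (Fin 3) ℝ) (ha : ∀ j i, |a j i| < 1) :
    corrPoly (scaledCorr Θ a) 1 = corrPoly (oppositeCorr Θ) fun j => blockRadius (a j) := by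
  rw [funext (scaledCorr_eq_mul_sqrt_mul_sqrt Θ ha),
    corrPoly_mul_mul _ fun j => √(blockRadius (a j))]
  simp only [Real.sq_sqrt (blockRadius_mem_Ico (ha _)).1, Pi.one_apply, mul_one]

lemma rhoSq_eq_norm_corrPoly_scaledCorr_sq (Θ : Matrix (Fin 3) (Fin 3) ℝ)
    (ha : ∀ j i, |a j i| < 1) (γ : Fin 3 → ℝ) :
    rhoSq Θ a γ = ‖corrPoly (fun j => (scaledCorr Θ a j : ℂ))
      fun j => (Real.cos (γ j) : ℂ) * Complex.exp (Complex.I * (γ j : ℂ))‖ ^ 2 := by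
  simp only [rhoSq_eq_norm_corrPoly_sq, scaledCorr_eq_mul_sqrt_mul_sqrt Θ ha, Complex.ofReal_mul]
  rw [corrPoly_mul_mul _ fun j => (√(blockRadius (a j)) : ℂ)]
  simp only [← Complex.ofReal_pow, Real.sq_sqrt (blockRadius_mem_Ico (ha _)).1, circlePoint,
    mul_assoc]

lemma scaledCorr_sq_lt_one (hΘ : Θ.PosSemidef) (hdiag : ∀ i, Θ i i = 1)
    (ha : ∀ j i, |a j i| < 1) (j : Fin 3) : scaledCorr Θ a j ^ 2 < 1 := by
  have hd := blockRadius_mem_Ico (ha (j + 1))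
  have hd' := blockRadius_mem_Ico (ha (j + 2))
  rw [scaledCorr, mul_pow, Real.sq_sqrt (mul_nonneg hd.1 hd'.1)]
  exact mul_lt_one_of_nonneg_of_lt_one_right (sq_le_one_of_posSemidef hΘ hdiag _ _)
    (mul_nonneg hd.1 hd'.1) (mul_lt_one_of_nonneg_of_lt_one_left hd.1 hd.2 hd'.2.le)

lemma corrPoly_blockRadius_lt_one (hΘ : Θ.PosSemidef) (hdiag : ∀ i, Θ i i = 1)
    (ha : ∀ j i, |a j i| < 1) :
    (corrPoly (oppositeCorr Θ) fun j => blockRadius (a j)) < 1 := by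
  set z : Fin 3 → ℝ := fun j => ∑ i, a j i ^ 2 / (1 - a j i ^ 2)
  have hz : ∀ j, 0 ≤ z j := fun j => sum_sq_div_one_sub_sq_nonneg (ha j)
  have hz' : ∀ j, 0 < 1 + z j := fun j => add_pos_of_pos_of_nonneg one_pos (hz j)
  have hdet := det_one_add_mul_diagonal_pos hΘ hz
  rw [det_one_add_mul_diagonal_eq_corrPoly (Matrix.isHermitian_iff_isSymm.1 hΘ.isHermitian) hdiag
    fun j => (hz' j).ne'] at hdet
  exact sub_pos.1 ((pos_iff_pos_of_mul_pos hdet).1 (Finset.prod_pos fun j _ => hz' j))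

lemma rhoSq_lt_one (hΘ : Θ.PosSemidef) (hdiag : ∀ i, Θ i i = 1) (ha : ∀ j i, |a j i| < 1)
    (hsum : ∑ j, scaledCorr Θ a j ^ 4 ≤ 1) (γ : Fin 3 → ℝ) : rhoSq Θ a γ < 1 := by
  have hsq := scaledCorr_sq_lt_one hΘ hdiag ha
  have habs : |corrPoly (scaledCorr Θ a) 1| < 1 := by
    rw [abs_of_nonneg (corrPoly_one_nonneg fun j => (hsq j).le), corrPoly_scaledCorr_one Θ ha]
    exact corrPoly_blockRadius_lt_one hΘ hdiag ha
  rw [rhoSq_eq_norm_corrPoly_scaledCorr_sq Θ ha, norm_corrPoly_cos_mul_exp_sq]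
  exact mul_prod_cos_sq_add_sum_sq_lt_one hsq hsum habs γ

lemma continuous_rhoSq (Θ : Matrix (Fin 3) (Fin 3) ℝ) (a : (j : Fin 3) → Fin (n j) → ℝ) :
    Continuous (rhoSq Θ a) := by
  unfold rhoSq circlePoint
  fun_prop

theorem maxRhoSqLtOne_of_sum_scaledCorr_pow_four_le_one (hΘ : Θ.PosSemidef)
    (hdiag : ∀ i, Θ i i = 1) (ha : ∀ j i, |a j i| < 1)
    (hsum : ∑ j, scaledCorr Θ a j ^ 4 ≤ 1) : MaxRhoSqLtOne Θ a := by
  have hcompact : IsCompact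
      {γ : Fin 3 → ℝ | ∀ j, γ j ∈ Icc (-(Real.pi / 2)) (Real.pi / 2)} :=
    isCompact_pi_infinite fun _ => isCompact_Icc
  have hnonempty : {γ : Fin 3 → ℝ | ∀ j, γ j ∈ Icc (-(Real.pi / 2)) (Real.pi / 2)}.Nonempty :=
    ⟨0, fun _ => ⟨neg_nonpos.2 Real.pi_div_two_pos.le, Real.pi_div_two_pos.le⟩⟩
  obtain ⟨M, hM⟩ := (hcompact.image (continuous_rhoSq Θ a)).exists_isGreatest (hnonempty.image _)
  obtain ⟨γ, -, rfl⟩ := hM.1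
  exact ⟨_, hM, rhoSq_lt_one hΘ hdiag ha hsum γ⟩

end ScaledCorr

theorem theorem5_general (n : Fin 3 → ℕ) (a : (j : Fin 3) → Fin (n j) → ℝ)
    (ha : ∀ j i, |a j i| < 1) (Θ : Matrix (Fin 3) (Fin 3) ℝ) (hsymm : Θ.IsSymm)
    (hdiag : ∀ i, Θ i i = 1) :
    (MaxRhoSqLtOne Θ a →
      ∀ α : ℝ, 0 < α → ∀ μ : Measure (((j : Fin 3) × Fin (n j)) → ℝ),
        IsMultivariateGamma α (blockCorrelation Θ a) μ →
        ∀ x : ((j : Fin 3) × Fin (n j)) → ℝ,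
          HasSum (gammaSeriesTerm α Θ a x) (μ.real (Set.Iic x))) ∧
    (Θ.PosSemidef → ∑ j : Fin 3, scaledCorr Θ a j ^ 4 ≤ 1 → MaxRhoSqLtOne Θ a) :=
  ⟨fun hmax _ hα _ hμ x => hasSum_gammaSeriesTerm hα ha hsymm hdiag hmax hμ x,
    fun hΘ hsum => maxRhoSqLtOne_of_sum_scaledCorr_pow_four_le_one hΘ hdiag ha hsum⟩

theorem theorem5 (n : Fin 3 → ℕ) (a : (j : Fin 3) → Fin (n j) → ℝ)
    (ha : ∀ j i, 0 < a j i ∧ a j i < 1)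
    (Θ : Matrix (Fin 3) (Fin 3) ℝ) (hΘ : IsNonsingularCorrelation Θ) :
    (MaxRhoSqLtOne Θ a →
      ∀ α : ℝ, 0 < α → ∀ μ : Measure (((j : Fin 3) × Fin (n j)) → ℝ),
        IsMultivariateGamma α (blockCorrelation Θ a) μ →
        ∀ x : ((j : Fin 3) × Fin (n j)) → ℝ,
          HasSum (gammaSeriesTerm α Θ a x) (μ.real (Set.Iic x))) ∧
    (∑ j : Fin 3, scaledCorr Θ a j ^ 4 ≤ 1 → MaxRhoSqLtOne Θ a) := by
  have hgeneral := theorem5_general n a (fun j i => abs_lt.2 ⟨by linarith [(ha j i).1], (ha j i).2⟩)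
    Θ (Matrix.isHermitian_iff_isSymm.1 hΘ.1.isHermitian) hΘ.2
  exact hgeneral.imp_right fun hsum => hsum hΘ.1.posSemidef
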